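/- **Notation.** For $h:\mathbb R^N\to[-\infty,\infty]$, $x$ with $h(x)$ finite, and $v,w,z\in\mathbb R^N$ let $\widehat\partial h(x)$ be the regular (Fréchet) subdifferential, $\partial h(x)$ the limiting (Mordukhovich) subdifferential, $$dh(x)(w)=\liminf_{\tau\downarrow0,\,w'\to w}\frac{h(x+\tau w')-h(x)}{\tau},\qquad \mathcal C_h(x,v)=\{w: dh(x)(w)=\langle v,w\rangle\},$$ $$d^2h(x)(w)=\liminf_{\tau\downarrow0,\,w'\to w}\frac{h(x+\tau w')-h(x)-\tau\, dh(x)(w')}{\tau^2/2},\qquad \Delta^2_\tau h(x|v)(w')=\frac{h(x+\tau w')-h(x)-\tau\langle v,w'\rangle}{\tau^2/2},$$ $$d^2h(x|v)(w)=\liminf_{\tau\downarrow0,\,w'\to w}\Delta^2_\tau h(x|v)(w'),\qquad d^2h(x)(w|z)=\liminf_{\tau\downarrow0,\,z'\to z}\frac{h(x+\tau w+\frac12\tau^2z')-h(x)-\tau\, dh(x)(w)}{\tau^2/2}.$$ $h$ is *parabolically regular* at $x$ for $v$ if $\inf_z\{d^2h(x)(w|z)-\langle v,z\rangle\}=d^2h(x|v)(w)$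 for every $w\in\mathcal C_h(x,v)$, and *properly twice epi-differentiable* at $x$ for $v$ if $\Delta^2_\tau h(x|v)$ epi-converges to $d^2h(x|v)$ as $\tau\downarrow0$ and $d^2h(x|v)$ is proper. A map $F$ into $\mathbb R^m$ is *semidifferentiable* at $x$ if for all $w$ and $i$ the finite limit $dF_i(x)(w)=\lim_{\tau\downarrow0,\,w'\to w}\frac{F_i(x+\tau w')-F_i(x)}{\tau}$ exists; its *parabolic semiderivative* has the components $$F_i''(x;w,z)=\lim_{\tau\downarrow0,\,z'\to z}\frac{F_i(x+\tau w+\frac12\tau^2z')-F_i(x)-\tau\, dF_i(x)(w)}{\tau^2/2},$$ where infinite limits are allowed; $F$ is *parabolically semidifferentiable* at $x$ if in addition all these limits exist and are finite. A function is *piecewise twice differentiable* (PWTD) if its domain is a nonempty finite union of polyhedral sets $\Omega_k$ on each of which it equals a function that is twice differentiable on an open superset of $\Omega_k$. A function is *regular* at a point if its epigraph is Clarke regular (regular normal cone = limiting normal cone) at the corresponding point of the graph. **Setting.** Let $q>1$, $\lambda>0$, let $\{J_1,\dots,J_m\}$ be a partition of $\{1,\dots,n\}$ into nonempty blocks, and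 let $\rho_\lambda:\mathbb R\to\mathbb R$ satisfy * (C.1) $\rho_\lambda$ is PWTD with $\rho_\lambda(0)=0$; * (C.2) $\rho_\lambda$ is differentiable at every $t\neq0$ and $\partial\rho_\lambda(0)=[-\lambda,\lambda]$; * (C.3) $\rho_\lambda$ is regular and locally Lipschitz continuous. Put $F(x)=(\|x_{J_1}\|_q,\dots,\|x_{J_m}\|_q)$ for $x\in\mathbb R^n$, $\vartheta(y)=\sum_{i=1}^m\rho_\lambda(y_i)$ for $y\in\mathbb R^m$, and $f=\vartheta\circ F$, i.e. $f(x)=\sum_{i=1}^m\rho_\lambda(\|x_{J_i}\|_q)$. **Proposition.** Let $\bar x\in\mathbb R^n$ and $\bar v\in\partial f(\bar x)$. If $q<2$ and some block $\bar x_{J_i}$ has both a zero and a nonzero entry, assume moreover that $\rho_\lambda$ is nondecreasing on $[0,\infty)$. Then: 1. $F$ is semidifferentiable at $\bar x$ and all the limits $F_i''(\bar x;w,z)$ exist in $[-\infty,\infty]$; if $q\ge2$, or if no block of $\bar x$ has both a zero and a nonzero entry, they are all finite, so that $F$ is parabolically semidifferentiable at $\bar x$. 2. There is $\bar\xi\in\partial\vartheta(F(\bar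 x))$ with $\langle\bar\xi,dF(\bar x)(w')\rangle\ge\langle\bar v,w'\rangle$ for all $w'\in\mathbb R^n$ such that, for every $w\in\mathcal C_f(\bar x,\bar v)$, $$\inf_{z\in\mathbb R^n}\Big\{\sup_{u\in\mathcal A(w)}\langle u,F''(\bar x;w,z)\rangle-\langle\bar v,z\rangle\Big\}=d^2(\bar\xi F)(\bar x)(w),$$ where $(\bar\xi F)(x)=\langle\bar\xi,F(x)\rangle$, $\mathcal A(w)=\{u\in\partial\vartheta(F(\bar x)): d\vartheta(F(\bar x))(dF(\bar x)(w))=\langle u,dF(\bar x)(w)\rangle\}$, and $\langle u,F''\rangle=\sum_iu_iF_i''$ with $0\cdot\infty=0$. 3. $f$ is parabolically regular at $\bar x$ for $\bar v$. 4. $f$ is properly twice epi-differentiable at $\bar x$ for $\bar v$. -/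

import Mathlib

open Filter Topology Set

noncomputable section

namespace VarAnalysis

/-! ## Extended real-valued functions, epigraphs, set convergence, epi-convergence -/

section General

variable {E : Type*} [NormedAddCommGroup E] [InnerProductSpace ℝ E]

/-- A real-valued function regarded as an extended real-valued one. -/
def realToExt {X : Type*} (g : X → ℝ) : X → EReal := fun x => ((g x : ℝ) : EReal)

/-- The effective domain. -/
def effDom {X : Type*} (h : X → EReal) : Set X := {x | h x < ⊤}

/-- The epigraph. -/
def epigraph {X : Type*} (h : X → EReal) : Set (X × ℝ) := {p | h p.1 ≤ (p.2 : EReal)}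

/-- `h` never takes the value `-∞` and is not identically `∞`. -/
def IsProper {X : Type*} (h : X → EReal) : Prop := (∀ x, h x ≠ ⊥) ∧ (effDom h).Nonempty

/-- Outer (upper) limit of sets in the sense of Painlevé and Kuratowski. -/
def outerLimit {T X : Type*} [TopologicalSpace X] (S : T → Set X) (l : Filter T) : Set X :=
  {x | ∀ V ∈ 𝓝 x, ∃ᶠ t in l, (S t ∩ V).Nonempty}

/-- Inner (lower) limit of sets in the sense of Painlevé and Kuratowski. -/
def innerLimit {T X : Type*} [TopologicalSpace X] (S : T → Set X) (l : Filter T) : Set X :=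
  {x | ∀ V ∈ 𝓝 x, ∀ᶠ t in l, (S t ∩ V).Nonempty}

/-- `H t` epi-converges to `h` along `l`: the lower epi-limit (whose epigraph is the outer limit
of the epigraphs) and the upper epi-limit (whose epigraph is the inner limit of the epigraphs)
both equal `h`. -/
def EpiConverges {T X : Type*} [TopologicalSpace X] (H : T → X → EReal) (l : Filter T)
    (h : X → EReal) : Prop :=
  epigraph h = outerLimit (fun t => epigraph (H t)) l ∧
    epigraph h = innerLimit (fun t => epigraph (H t)) l

/-! ## Subdifferentials, normal cones, regularity -/

/-- Regular (Fréchet) subdifferential; empty where `h` is not finite. -/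
def regSubdiff (h : E → EReal) (x : E) : Set E :=
  {v | h x ≠ ⊤ ∧ h x ≠ ⊥ ∧
    0 ≤ liminf (fun x' => (h x' - h x - ((inner ℝ v (x' - x) : ℝ) : EReal))
      / ((‖x' - x‖ : ℝ) : EReal)) (𝓝[≠] x)}

/-- Basic (limiting, Mordukhovich) subdifferential; empty where `h` is not finite. -/
def subdiff (h : E → EReal) (x : E) : Set E :=
  {v | h x ≠ ⊤ ∧ h x ≠ ⊥ ∧ ∃ (y : ℕ → E) (u : ℕ → E),
    Tendsto y atTop (𝓝 x) ∧ Tendsto (fun k => h (y k)) atTop (𝓝 (h x)) ∧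
      (∀ k, u k ∈ regSubdiff h (y k)) ∧ Tendsto u atTop (𝓝 v)}

open Classical in
/-- The indicator function of a set in the sense of variational analysis. -/
def indicatorFun {X : Type*} (S : Set X) : X → EReal := fun x => if x ∈ S then 0 else ⊤

/-- Regular normal cone. -/
def regNormalCone (S : Set E) (x : E) : Set E := regSubdiff (indicatorFun S) x

/-- (Limiting) normal cone. -/
def normalCone (S : Set E) (x : E) : Set E := subdiff (indicatorFun S) x

/-- Clarke regularity of a set at a point. -/
def ClarkeRegularAt (S : Set E) (x : E) : Prop := regNormalCone S x = normalCone S x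

/-- `h` is (subdifferentially) regular at `x`: it is finite there and its epigraph, as a subset of
the Euclidean product `E × ℝ`, is Clarke regular at `(x, h x)`. -/
def RegularAt (h : E → EReal) (x : E) : Prop :=
  h x ≠ ⊤ ∧ h x ≠ ⊥ ∧
    ClarkeRegularAt {p : WithLp 2 (E × ℝ) | h p.fst ≤ (p.snd : EReal)}
      (WithLp.toLp 2 (x, (h x).toReal))

/-! ## First- and second-order subderivatives -/

/-- The subderivative `dh(x)(w)`. -/
def subderiv (h : E → EReal) (x w : E) : EReal :=
  liminf (fun p : ℝ × E => (h (x + p.1 • p.2) - h x) / (p.1 : EReal)) (𝓝[>] (0 : ℝ) ×ˢ 𝓝 w)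

/-- The critical cone `C_h(x, v)`. -/
def criticalCone (h : E → EReal) (x v : E) : Set E :=
  {w | subderiv h x w = ((inner ℝ v w : ℝ) : EReal)}

open Classical in
/-- Second-order difference quotient `Δ²_τ h(x)(w')`, by convention `∞` when
`h (x + τ w')` and `dh(x)(w')` are the same infinity. -/
def secondQuot (h : E → EReal) (x : E) (τ : ℝ) (w' : E) : EReal :=
  if (h (x + τ • w') = ⊤ ∧ subderiv h x w' = ⊤) ∨ (h (x + τ • w') = ⊥ ∧ subderiv h x w' = ⊥) then ⊤
  else (h (x + τ • w') - h x - (τ : EReal) * subderiv h x w') / ((τ ^ 2 / 2 : ℝ) : EReal)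

/-- Second-order difference quotient `Δ²_τ h(x|v)(w')`. -/
def secondQuotFor (h : E → EReal) (x v : E) (τ : ℝ) (w' : E) : EReal :=
  (h (x + τ • w') - h x - ((τ * inner ℝ v w' : ℝ) : EReal)) / ((τ ^ 2 / 2 : ℝ) : EReal)

/-- Second subderivative `d²h(x)(w)` (without mention of `v`). -/
def secondSubderiv (h : E → EReal) (x w : E) : EReal :=
  liminf (fun p : ℝ × E => secondQuot h x p.1 p.2) (𝓝[>] (0 : ℝ) ×ˢ 𝓝 w)

/-- Second subderivative `d²h(x|v)(w)`. -/
def secondSubderivFor (h : E → EReal) (x v w : E) : EReal :=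
  liminf (fun p : ℝ × E => secondQuotFor h x v p.1 p.2) (𝓝[>] (0 : ℝ) ×ˢ 𝓝 w)

/-- `h` is properly twice epi-differentiable at `x` for `v`. -/
def ProperlyTwiceEpiDifferentiableAt (h : E → EReal) (x v : E) : Prop :=
  EpiConverges (fun τ : ℝ => secondQuotFor h x v τ) (𝓝[>] (0 : ℝ)) (secondSubderivFor h x v) ∧
    IsProper (secondSubderivFor h x v)

/-- Parabolic subderivative `d²h(x)(w|z)`; meaningful when `dh(x)(w)` is finite. -/
def parabolicSubderiv (h : E → EReal) (x w z : E) : EReal :=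
  liminf (fun p : ℝ × E =>
      (h (x + p.1 • w + (p.1 ^ 2 / 2) • p.2) - h x - (p.1 : EReal) * subderiv h x w)
        / ((p.1 ^ 2 / 2 : ℝ) : EReal))
    (𝓝[>] (0 : ℝ) ×ˢ 𝓝 z)

/-- `h` is parabolically regular at `x` for `v`. -/
def ParabolicallyRegularAt (h : E → EReal) (x v : E) : Prop :=
  h x ≠ ⊤ ∧ h x ≠ ⊥ ∧
    ∀ w, subderiv h x w = ((inner ℝ v w : ℝ) : EReal) →
      ⨅ z, (parabolicSubderiv h x w z - ((inner ℝ v z : ℝ) : EReal)) = secondSubderivFor h x v w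

/-! ## Piecewise twice differentiable functions -/

/-- Polyhedral set: a finite intersection of closed half-spaces. -/
def IsPolyhedral (S : Set E) : Prop :=
  ∃ (k : ℕ) (a : Fin k → E) (b : Fin k → ℝ), S = {x | ∀ i, inner ℝ (a i) x ≤ b i}

/-- Piecewise twice differentiable (PWTD) function. -/
def IsPWTD (h : E → EReal) : Prop :=
  (effDom h).Nonempty ∧
    ∃ (s : ℕ) (Ω : Fin s → Set E), effDom h = ⋃ i, Ω i ∧
      ∀ i, IsPolyhedral (Ω i) ∧
        ∃ (O : Set E) (g : E → ℝ), IsOpen O ∧ Ω i ⊆ O ∧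
          (∀ x ∈ O, DifferentiableAt ℝ g x ∧ DifferentiableAt ℝ (fderiv ℝ g) x) ∧
          ∀ x ∈ Ω i, h x = ((g x : ℝ) : EReal)

/-! ## (Parabolic) semidifferentiability -/

/-- First-order difference quotient of a real-valued function, as a function of `(τ, w')`. -/
def quot (g : E → ℝ) (x : E) (p : ℝ × E) : ℝ := (g (x + p.1 • p.2) - g x) / p.1

/-- `g` is semidifferentiable at `x` for `w`: the limit exists and is finite. -/
def SemidifferentiableAt (g : E → ℝ) (x w : E) : Prop :=
  ∃ L : ℝ, Tendsto (quot g x) (𝓝[>] (0 : ℝ) ×ˢ 𝓝 w) (𝓝 L)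

/-- The semiderivative `dg(x)(w)` of a semidifferentiable function. -/
def semideriv (g : E → ℝ) (x w : E) : ℝ := limUnder (𝓝[>] (0 : ℝ) ×ˢ 𝓝 w) (quot g x)

/-- Parabolic difference quotient `Δ²_τ g(x)(w|z')`, as a function of `(τ, z')`. -/
def parabolicQuot (g : E → ℝ) (x w : E) (p : ℝ × E) : ℝ :=
  (g (x + p.1 • w + (p.1 ^ 2 / 2) • p.2) - g x - p.1 * semideriv g x w) / (p.1 ^ 2 / 2)

/-- `g` has `L`, possibly infinite, as parabolic semiderivative at `x` for `w` with respect
to `z`. -/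
def HasParabolicSemideriv (g : E → ℝ) (x w z : E) (L : EReal) : Prop :=
  Tendsto (fun p => ((parabolicQuot g x w p : ℝ) : EReal)) (𝓝[>] (0 : ℝ) ×ˢ 𝓝 z) (𝓝 L)

/-- The parabolic semiderivative `g''(x; w, z)`, allowed to be infinite. -/
def parabolicSemideriv (g : E → ℝ) (x w z : E) : EReal :=
  limUnder (𝓝[>] (0 : ℝ) ×ˢ 𝓝 z) (fun p => ((parabolicQuot g x w p : ℝ) : EReal))

variable {m : ℕ}

/-- The mapping `G` is semidifferentiable at `x`. -/
def MapSemidifferentiableAt (G : E → EuclideanSpace ℝ (Fin m)) (x : E) : Prop :=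
  ∀ (w : E) (i : Fin m), SemidifferentiableAt (fun y => G y i) x w

/-- The semiderivative `dG(x)(w)` of a mapping. -/
def mapSemideriv (G : E → EuclideanSpace ℝ (Fin m)) (x w : E) : EuclideanSpace ℝ (Fin m) :=
  WithLp.toLp 2 (fun i => semideriv (fun y => G y i) x w)

/-- The mapping `G` is parabolically semidifferentiable at `x` (all the limits being finite). -/
def MapParabolicallySemidifferentiableAt (G : E → EuclideanSpace ℝ (Fin m)) (x : E) : Prop :=
  MapSemidifferentiableAt G x ∧
    ∀ (w z : E) (i : Fin m), ∃ L : ℝ, HasParabolicSemideriv (fun y => G y i) x w z (L : EReal)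

/-- `⟨u, G''(x; w, z)⟩`, a sum of extended reals with the convention `0 · ∞ = 0`. -/
def pairParabolic (u : EuclideanSpace ℝ (Fin m)) (G : E → EuclideanSpace ℝ (Fin m))
    (x w z : E) : EReal :=
  ∑ i, (u i : EReal) * parabolicSemideriv (fun y => G y i) x w z

/-! ## The second-order condition for a composition `θ ∘ G` -/

/-- The multiplier set `Λ_{x,v}`. -/
def multiplierSet (θ : EuclideanSpace ℝ (Fin m) → EReal) (G : E → EuclideanSpace ℝ (Fin m))
    (x v : E) : Set (EuclideanSpace ℝ (Fin m)) :=
  {ξ | ξ ∈ subdiff θ (G x) ∧ ∀ w', inner ℝ v w' ≤ inner ℝ ξ (mapSemideriv G x w')}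

/-- The set `A_θ(y, d)` of subgradients active in the direction `d`. -/
def activeSubgradients (θ : EuclideanSpace ℝ (Fin m) → EReal) (y d : EuclideanSpace ℝ (Fin m)) :
    Set (EuclideanSpace ℝ (Fin m)) :=
  {u | u ∈ subdiff θ y ∧ subderiv θ y d = ((inner ℝ u d : ℝ) : EReal)}

/-- There is `ξ ∈ Λ_{x,v}` such that, for every critical direction `w` of `θ ∘ G`,
`inf_z { sup_{u ∈ A} ⟨u, G''(x; w, z)⟩ - ⟨v, z⟩ } = d²(ξG)(x)(w)`. -/
def SufficientCondition (θ : EuclideanSpace ℝ (Fin m) → EReal)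
    (G : E → EuclideanSpace ℝ (Fin m)) (x v : E) : Prop :=
  ∃ ξ ∈ multiplierSet θ G x v, ∀ w ∈ criticalCone (fun y => θ (G y)) x v,
    ⨅ z, ((⨆ u ∈ activeSubgradients θ (G x) (mapSemideriv G x w), pairParabolic u G x w z)
        - ((inner ℝ v z : ℝ) : EReal))
      = secondSubderiv (realToExt fun y => inner ℝ ξ (G y)) x w

end General

/-! ## Group sparsity functions -/

/-- The family `J` lists the (nonempty, pairwise disjoint) blocks of a partition of `Fin n`. -/
def IsBlockPartition {n m : ℕ} (J : Fin m → Finset (Fin n)) : Prop :=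
  (∀ i, (J i).Nonempty) ∧ Pairwise (fun i k => Disjoint (J i) (J k)) ∧ ∀ j, ∃ i, j ∈ J i

/-- The mapping `x ↦ (‖x_{J_1}‖_q, …, ‖x_{J_m}‖_q)`. -/
def blockNorms {n m : ℕ} (q : ℝ) (J : Fin m → Finset (Fin n)) (x : EuclideanSpace ℝ (Fin n)) :
    EuclideanSpace ℝ (Fin m) :=
  WithLp.toLp 2 (fun i => (∑ j ∈ J i, |x j| ^ q) ^ (1 / q))

/-- The separable function `y ↦ ∑ i, ρ (y i)`. -/
def separableSum {m : ℕ} (ρ : ℝ → ℝ) (y : EuclideanSpace ℝ (Fin m)) : ℝ := ∑ i, ρ (y i)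

/-- Some block of `x` has both a zero and a nonzero entry. -/
def HasMixedBlock {n m : ℕ} (J : Fin m → Finset (Fin n)) (x : EuclideanSpace ℝ (Fin n)) : Prop :=
  ∃ i, (∃ j ∈ J i, x j = 0) ∧ ∃ j ∈ J i, x j ≠ 0

/-- The conditions on the scalar penalty `ρ` with parameter `lam`. -/
structure IsPenalty (lam : ℝ) (ρ : ℝ → ℝ) : Prop where
  pwtd : IsPWTD (realToExt ρ)
  map_zero : ρ 0 = 0
  differentiableAt : ∀ t, t ≠ 0 → DifferentiableAt ℝ ρ t
  subdiff_zero : subdiff (realToExt ρ) 0 = Icc (-lam) lam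
  regular : ∀ t, RegularAt (realToExt ρ) t
  locallyLipschitz : LocallyLipschitz ρ

end VarAnalysis

end

/-! # Second-order properties of group sparsity functions

Write `N` for the `q`-norm of a block, `a` for the slope of the penalty `ρ` at `N x` (its derivative
if `N x > 0`, and `lam` if `N x = 0`) and `dN` for the semiderivative of `N` at `x`. Since `N ≥ 0`,
only `ρ` on `[0, ∞)` enters the composite function `f`, and there `ρ` has slope `a` and a one-sided
second-order expansion; at the origin this rests on `∂ρ(0) = [-lam, lam]`
(`IsPenalty.exists_slopes_zero`, `IsPenalty.exists_expansion`). Hence the directional derivative of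
`f` is the sum of the terms `a dN(w)` over the blocks, and as it is upper semicontinuous in the base
point, every limiting subgradient `v` satisfies `⟨v, w⟩ ≤ a dN(w)` in each block
(`IsPenalty.blockInner_le`).

The contribution of a block to the second-order quotient `Δ²_τ f(x|v)(w')` splits into three terms:
the second-order remainder of `ρ`, which has a limit as `τ ↓ 0` and `w' → w`; the second-order
quotient of `N` times `a`; and `2 (a dN(w') - ⟨v, w'⟩) / τ ≥ 0`. Each of them has a lower epi-limit
that is already attained along the constant directions `w' = w`; this is the notion `EpiLimAt`, which
is stable under sums. For the second term (`exists_epiLimAt_blockNorm`) the only terms without a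
finite limit are the powers `|x_j|^q` with `x_j = 0` and `q < 2`, whose quotients are nonnegative and
of order `τ^(q - 2) |w_j|^q`; this is where monotonicity of `ρ`, that is `a ≥ 0`, is needed.

Recovery along constant directions gives epi-convergence at once
(`properlyTwiceEpiDifferentiableAt_of_epiLimAt`), and parabolic regularity as well
(`parabolicallyRegularAt_of_epiLimAt`): for critical `w`, the parabolic quotient at `z'` minus
`⟨v, z'⟩` is the second-order quotient at `w + (τ / 2) z'`, so that no `z` does better than `z = 0`.
The same substitution computes the parabolic semiderivatives of the block norms, and the vector of
slopes `a` is a multiplier for which the infimum in the second-order condition is attained at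
`z = 0` (`IsPenalty.sufficientCondition`). -/

namespace VarAnalysis

/-! ### Second-order expansions of scalar functions -/

/-- `g (s + h) = g s + a h + o(h²)` up to the second-order terms `cp h² / 2` for `h ≥ 0` and
`cm h² / 2` for `h ≤ 0`, as `h → 0` within `A`. -/
def HasSecondOrderExpansion (g : ℝ → ℝ) (s a cp cm : ℝ) (A : Set ℝ) : Prop :=
  ∀ ε > 0, ∀ᶠ h in 𝓝[A] (0 : ℝ),
    |g (s + h) - g s - a * h - (cp * (max h 0) ^ 2 + cm * (min h 0) ^ 2) / 2| ≤ ε * h ^ 2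

/-- The second-order difference quotient of `g` at `s` with slope `a`, as a function of the
step `p.1` and the direction `p.2`. -/
noncomputable def secondRem (g : ℝ → ℝ) (s a : ℝ) (p : ℝ × ℝ) : ℝ :=
  (g (s + p.1 * p.2) - g s - a * (p.1 * p.2)) / (p.1 ^ 2 / 2)

lemma HasSecondOrderExpansion.tendsto {α : Type*} {l : Filter α} {g : ℝ → ℝ}
    {s a cp cm d : ℝ} {A : Set ℝ} (h : HasSecondOrderExpansion g s a cp cm A) {τ δ : α → ℝ}
    (hτ : Tendsto τ l (𝓝[>] 0)) (hδ : Tendsto δ l (𝓝 d)) (hA : ∀ᶠ i in l, τ i * δ i ∈ A) :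
    Tendsto (fun i => secondRem g s a (τ i, δ i)) l
      (𝓝 (cp * (max d 0) ^ 2 + cm * (min d 0) ^ 2)) := by
  have hτ0 : Tendsto τ l (𝓝 0) := hτ.mono_right nhdsWithin_le_nhds
  have hτpos : ∀ᶠ i in l, 0 < τ i := hτ.eventually self_mem_nhdsWithin
  have hprod : Tendsto (fun i => τ i * δ i) l (𝓝[A] 0) := by
    refine tendsto_nhdsWithin_iff.2 ⟨?_, hA⟩
    simpa using hτ0.mul hδ
  have hmain : Tendsto (fun i => secondRem g s a (τ i, δ i)
      - (cp * (max (δ i) 0) ^ 2 + cm * (min (δ i) 0) ^ 2)) l (𝓝 0) := by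
    rw [Metric.tendsto_nhds]
    intro ε hε
    have hM : ∀ᶠ i in l, |δ i| < |d| + 1 := hδ.abs.eventually (gt_mem_nhds (by linarith))
    have hε' : 0 < ε / (4 * (|d| + 1) ^ 2) := by positivity
    filter_upwards [hτpos, hprod.eventually (h _ hε'), hM] with i hi h1 h2
    rw [Real.dist_eq, sub_zero]
    have e1 : max (τ i * δ i) 0 = τ i * max (δ i) 0 := by
      rw [mul_max_of_nonneg _ _ hi.le, mul_zero]
    have e2 : min (τ i * δ i) 0 = τ i * min (δ i) 0 := by
      rw [mul_min_of_nonneg _ _ hi.le, mul_zero]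
    have e3 : secondRem g s a (τ i, δ i)
        - (cp * (max (δ i) 0) ^ 2 + cm * (min (δ i) 0) ^ 2)
        = (g (s + τ i * δ i) - g s - a * (τ i * δ i)
          - (cp * (max (τ i * δ i) 0) ^ 2 + cm * (min (τ i * δ i) 0) ^ 2) / 2)
            / (τ i ^ 2 / 2) := by
      rw [e1, e2, secondRem]
      field_simp
    rw [e3, abs_div, abs_of_pos (by positivity : 0 < τ i ^ 2 / 2), div_lt_iff₀ (by positivity)]
    refine h1.trans_lt ?_
    have h3 : δ i ^ 2 ≤ (|d| + 1) ^ 2 := by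
      rw [← sq_abs (δ i)]
      exact pow_le_pow_left₀ (abs_nonneg _) h2.le 2
    have h4 : ε / (4 * (|d| + 1) ^ 2) * (|d| + 1) ^ 2 = ε / 4 := by
      field_simp
    have h5 : ε / (4 * (|d| + 1) ^ 2) * δ i ^ 2 ≤ ε / 4 := by
      rw [← h4]; exact mul_le_mul_of_nonneg_left h3 hε'.le
    have h6 : 0 < τ i ^ 2 := by positivity
    calc ε / (4 * (|d| + 1) ^ 2) * (τ i * δ i) ^ 2
        = ε / (4 * (|d| + 1) ^ 2) * δ i ^ 2 * τ i ^ 2 := by ring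
      _ ≤ ε / 4 * τ i ^ 2 := mul_le_mul_of_nonneg_right h5 h6.le
      _ < ε * (τ i ^ 2 / 2) := by nlinarith
  have hC : Tendsto (fun i => cp * (max (δ i) 0) ^ 2 + cm * (min (δ i) 0) ^ 2) l
      (𝓝 (cp * (max d 0) ^ 2 + cm * (min d 0) ^ 2)) :=
    (((hδ.max tendsto_const_nhds).pow 2).const_mul cp).add
      (((hδ.min tendsto_const_nhds).pow 2).const_mul cm)
  simpa using hmain.add hC

/-- Taylor's formula of order two with Peano remainder, for a function that is only twice
differentiable at the base point. -/
lemma taylor_two_peano {g : ℝ → ℝ} {s : ℝ} (h1 : ∀ᶠ y in 𝓝 s, DifferentiableAt ℝ g y)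
    (h2 : DifferentiableAt ℝ (deriv g) s) :
    HasSecondOrderExpansion g s (deriv g s) (deriv (deriv g) s) (deriv (deriv g) s) univ := by
  intro ε hε
  set c := deriv (deriv g) s
  have hd : ∀ᶠ y in 𝓝 s, |deriv g y - deriv g s - c * (y - s)| ≤ ε * |y - s| := by
    have := h2.hasDerivAt.isLittleO.def hε
    filter_upwards [this] with y hy
    simpa [mul_comm] using hy
  obtain ⟨r, hr, hball⟩ := Metric.eventually_nhds_iff_ball.1 (h1.and hd)
  rw [nhdsWithin_univ]
  filter_upwards [Metric.ball_mem_nhds (0 : ℝ) hr] with h hh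
  have hh' : |h| < r := by simpa using hh
  set k : ℝ → ℝ := fun u => g (s + u) - deriv g s * u - c / 2 * u ^ 2 with hk
  have hder : ∀ u ∈ uIcc 0 h, HasDerivWithinAt k (deriv g (s + u) - deriv g s - c * u)
      (uIcc 0 h) u := by
    intro u hu
    have hu' : |u| ≤ |h| := by simpa using abs_sub_left_of_mem_uIcc hu
    have hmem : s + u ∈ Metric.ball s r := by
      simpa [Real.dist_eq] using hu'.trans_lt hh'
    have hg : HasDerivAt (fun u => g (s + u)) (deriv g (s + u)) u :=
      HasDerivAt.comp_const_add s u (hball _ hmem).1.hasDerivAt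
    have : HasDerivAt k (deriv g (s + u) - deriv g s * 1 - c / 2 * (2 * u)) u := by
      refine (hg.sub ((hasDerivAt_id u).const_mul _)).sub ?_
      simpa using (hasDerivAt_pow 2 u).const_mul (c / 2)
    refine (this.congr_deriv (by ring)).hasDerivWithinAt
  have hbound : ∀ u ∈ uIcc 0 h, ‖deriv g (s + u) - deriv g s - c * u‖ ≤ ε * |h| := by
    intro u hu
    have hu' : |u| ≤ |h| := by simpa using abs_sub_left_of_mem_uIcc hu
    have hmem : s + u ∈ Metric.ball s r := by
      simpa [Real.dist_eq] using hu'.trans_lt hh'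
    have := (hball _ hmem).2
    rw [add_sub_cancel_left] at this
    exact this.trans (mul_le_mul_of_nonneg_left hu' hε.le)
  have := (convex_uIcc (0 : ℝ) h).norm_image_sub_le_of_norm_hasDerivWithin_le hder hbound
    left_mem_uIcc right_mem_uIcc
  have e : max h 0 ^ 2 + min h 0 ^ 2 = h ^ 2 := by
    rcases le_total h 0 with h0 | h0 <;> simp [h0]
  rw [← mul_add, e]
  simp only [hk, Real.norm_eq_abs, sub_zero, add_zero, mul_zero] at this
  calc _ = |g (s + h) - deriv g s * h - c / 2 * h ^ 2 - (g s - c / 2 * 0 ^ 2)| := by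
        congr 1; ring
    _ ≤ ε * |h| * |h| := this
    _ = ε * h ^ 2 := by rw [mul_assoc, ← sq, sq_abs]

/-! ### Piecewise twice differentiable functions on the line -/

lemma IsPolyhedral.isClosed_convex {E : Type*} [NormedAddCommGroup E] [InnerProductSpace ℝ E]
    {S : Set E} (h : IsPolyhedral S) : IsClosed S ∧ Convex ℝ S := by
  obtain ⟨k, a, b, rfl⟩ := h
  simp only [ofPred_forall]
  constructor
  · exact isClosed_iInter fun i =>
      isClosed_le (continuous_const.inner continuous_id) continuous_const
  · refine convex_iInter fun i => ?_
    exact convex_halfSpace_le ⟨fun x y => inner_add_right _ _ _,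
      fun c x => real_inner_smul_right _ _ _⟩ _

/-- On a short interval to either side of a point, a finite-valued PWTD function coincides with
a single one of its pieces. -/
lemma IsPWTD.exists_piece {ρ : ℝ → ℝ} (h : IsPWTD (realToExt ρ)) (t σ : ℝ) :
    ∃ g : ℝ → ℝ, ∃ r > 0, ∀ u ∈ Icc 0 r, ρ (t + σ * u) = g (t + σ * u) ∧
      (∀ᶠ y in 𝓝 (t + σ * u), DifferentiableAt ℝ g y) ∧
      DifferentiableAt ℝ (deriv g) (t + σ * u) := by
  obtain ⟨-, s, Ω, hΩ, hp⟩ := h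
  have hcover : ∀ y : ℝ, ∃ i, y ∈ Ω i := by
    intro y
    have : y ∈ effDom (realToExt ρ) := EReal.coe_lt_top _
    rw [hΩ] at this
    simpa using this
  -- One of the finitely many closed convex pieces contains points arbitrarily close to `t` on the
  -- chosen side, hence `t` itself and a whole interval.
  have hfreq : ∃ i, ∃ᶠ u in 𝓝[>] (0 : ℝ), t + σ * u ∈ Ω i := by
    by_contra hcon
    simp only [not_exists, not_frequently] at hcon
    obtain ⟨u, hu⟩ := (eventually_all.2 hcon).exists
    obtain ⟨i, hi⟩ := hcover (t + σ * u)
    exact hu i hi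
  obtain ⟨i, hi⟩ := hfreq
  obtain ⟨hpoly, O, g, hO, hsub, hdiff, heq⟩ := hp i
  obtain ⟨hcl, hconv⟩ := hpoly.isClosed_convex
  obtain ⟨r, hr, hr0⟩ := (hi.and_eventually self_mem_nhdsWithin).exists
  have htend : Tendsto (fun u : ℝ => t + σ * u) (𝓝[>] 0) (𝓝 t) := by
    have : Continuous (fun u : ℝ => t + σ * u) := by fun_prop
    simpa using (this.tendsto 0).mono_left nhdsWithin_le_nhds
  have ht : t ∈ Ω i := hcl.mem_of_frequently_of_tendsto hi htend
  refine ⟨g, r, hr0, fun u hu => ?_⟩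
  have hr0' : 0 < r := hr0
  have hmem : t + σ * u ∈ Ω i := by
    have := hconv.add_smul_sub_mem ht hr (t := u / r)
      ⟨div_nonneg hu.1 hr0'.le, (div_le_one hr0').2 hu.2⟩
    convert this using 1
    simp only [smul_eq_mul]
    field_simp
    ring
  refine ⟨by simpa [realToExt] using heq _ hmem, ?_, ?_⟩
  · filter_upwards [hO.mem_nhds (hsub hmem)] with y hy using (hdiff y hy).1
  · have := (hdiff _ (hsub hmem)).2.clm_apply (differentiableAt_const (1 : ℝ))
    exact this

/-- One-sided consequences of piecewise twice differentiability: on the side of `t` selected by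
the sign `σ`, the function has a slope `a` and a second-order expansion, and its derivatives tend
to `a`. -/
lemma IsPWTD.exists_oneSided {ρ : ℝ → ℝ} (h : IsPWTD (realToExt ρ)) (t : ℝ) {σ : ℝ}
    (hσ : σ * σ = 1) :
    ∃ a c : ℝ, HasSecondOrderExpansion ρ t a c c {u | 0 ≤ σ * u} ∧
      HasDerivWithinAt ρ a {y | 0 ≤ σ * (y - t)} t ∧
      Tendsto (deriv ρ) (𝓝[{y | 0 < σ * (y - t)}] t) (𝓝 a) := by
  obtain ⟨g, r, hr, hg⟩ := h.exists_piece t σ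
  have hσ' : |σ| = 1 := by
    rcases mul_self_eq_one_iff.1 hσ with rfl | rfl <;> simp
  have hg' : ∀ y, 0 ≤ σ * (y - t) → |y - t| ≤ r → ρ y = g y ∧
      (∀ᶠ z in 𝓝 y, DifferentiableAt ℝ g z) ∧ DifferentiableAt ℝ (deriv g) y := by
    intro y hy hyr
    have e : t + σ * (σ * (y - t)) = y := by rw [← mul_assoc, hσ]; ring
    have := hg (σ * (y - t)) ⟨hy, (le_abs_self _).trans (by rwa [abs_mul, hσ', one_mul])⟩
    rwa [e] at this
  obtain ⟨ht0, ht1, ht2⟩ := hg' t (by simp) (by simpa using hr.le)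
  have hnear : ∀ᶠ y in 𝓝 t, |y - t| < r := by
    exact (isOpen_lt (by fun_prop) continuous_const).mem_nhds (by simpa using hr)
  refine ⟨deriv g t, deriv (deriv g) t, ?_, ?_, ?_⟩
  · intro ε hε
    have h1 := taylor_two_peano ht1 ht2 ε hε
    rw [nhdsWithin_univ] at h1
    have hnear0 : ∀ᶠ u in 𝓝 (0 : ℝ), |u| < r := by
      exact (isOpen_lt continuous_abs continuous_const).mem_nhds (by simpa using hr)
    filter_upwards [nhdsWithin_le_nhds h1, nhdsWithin_le_nhds hnear0,
      self_mem_nhdsWithin] with u hu hur hus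
    have := (hg' (t + u) (by simpa using hus) (by simpa using hur.le)).1
    rwa [this, ht0]
  · refine ht1.self_of_nhds.hasDerivAt.hasDerivWithinAt.congr_of_eventuallyEq ?_ ht0
    filter_upwards [nhdsWithin_le_nhds hnear, self_mem_nhdsWithin] with y hy hys
    exact (hg' y hys hy.le).1
  · have h1 : Tendsto (deriv g) (𝓝[{y | 0 < σ * (y - t)}] t) (𝓝 (deriv g t)) :=
      ht2.continuousAt.tendsto.mono_left nhdsWithin_le_nhds
    refine h1.congr' ?_
    have hopen : IsOpen {y : ℝ | 0 < σ * (y - t)} :=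
      isOpen_lt continuous_const (by fun_prop)
    filter_upwards [nhdsWithin_le_nhds hnear, self_mem_nhdsWithin] with y hy hys
    refine (EventuallyEq.deriv_eq ?_).symm
    have hnear' : ∀ᶠ z in 𝓝 y, |z - t| < r :=
      (isOpen_lt (by fun_prop) continuous_const).mem_nhds hy
    filter_upwards [hopen.mem_nhds hys, hnear'] with z hz hzr
    exact (hg' z (le_of_lt hz) hzr.le).1

/-! ### Regular subgradients and subderivatives of real-valued functions -/

section

variable {E : Type*} [NormedAddCommGroup E] [InnerProductSpace ℝ E]

lemma mem_regSubdiff_realToExt {g : E → ℝ} {x v : E} :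
    v ∈ regSubdiff (realToExt g) x ↔
      ∀ ε > 0, ∀ᶠ y in 𝓝 x, -(ε * ‖y - x‖) ≤ g y - g x - inner ℝ v (y - x) := by
  have hfun : (fun x' => (realToExt g x' - realToExt g x - ((inner ℝ v (x' - x) : ℝ) : EReal))
      / ((‖x' - x‖ : ℝ) : EReal))
      = fun x' => (((g x' - g x - inner ℝ v (x' - x)) / ‖x' - x‖ : ℝ) : EReal) := by
    funext x'
    simp only [realToExt]
    rw [← EReal.coe_sub, ← EReal.coe_sub, ← EReal.coe_div]
  have hne : realToExt g x ≠ ⊤ ∧ realToExt g x ≠ ⊥ :=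
    ⟨EReal.coe_ne_top _, EReal.coe_ne_bot _⟩
  have hmem : v ∈ regSubdiff (realToExt g) x ↔ 0 ≤ liminf (fun x' =>
      (((g x' - g x - inner ℝ v (x' - x)) / ‖x' - x‖ : ℝ) : EReal)) (𝓝[≠] x) := by
    rw [← hfun]
    exact ⟨fun h => h.2.2, fun h => ⟨hne.1, hne.2, h⟩⟩
  rw [hmem, le_liminf_iff]
  constructor
  · intro h ε hε
    have h1 := h ((-ε : ℝ) : EReal) (by exact_mod_cast neg_lt_zero.2 hε)
    rw [eventually_nhdsWithin_iff] at h1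
    filter_upwards [h1] with y hy
    rcases eq_or_ne y x with rfl | hyx
    · simp
    · have := EReal.coe_lt_coe_iff.1 (hy hyx)
      have hpos : 0 < ‖y - x‖ := norm_pos_iff.2 (sub_ne_zero.2 hyx)
      rw [lt_div_iff₀ hpos] at this
      linarith
  · intro h c hc
    induction c with
    | bot => exact Eventually.of_forall fun _ => EReal.bot_lt_coe _
    | top => exact absurd hc (by simp)
    | coe c =>
      have hc' : c < 0 := by exact_mod_cast hc
      filter_upwards [nhdsWithin_le_nhds (h (-c / 2) (by linarith)), self_mem_nhdsWithin]
        with y hy hyx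
      have hpos : 0 < ‖y - x‖ := norm_pos_iff.2 (sub_ne_zero.2 hyx)
      rw [EReal.coe_lt_coe_iff, lt_div_iff₀ hpos]
      nlinarith

lemma regSubdiff_subset_subdiff {h : E → EReal} {x : E} : regSubdiff h x ⊆ subdiff h x :=
  fun v hv => ⟨hv.1, hv.2.1, fun _ => x, fun _ => v, tendsto_const_nhds, tendsto_const_nhds,
    fun _ => hv, tendsto_const_nhds⟩

/-- A regular subgradient is dominated by every one-sided directional derivative. -/
lemma inner_le_of_mem_regSubdiff {g : E → ℝ} {x v w : E} (hv : v ∈ regSubdiff (realToExt g) x)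
    {L : ℝ} (hL : Tendsto (fun τ : ℝ => (g (x + τ • w) - g x) / τ) (𝓝[>] 0) (𝓝 L)) :
    inner ℝ v w ≤ L := by
  rw [mem_regSubdiff_realToExt] at hv
  have hpath : Tendsto (fun τ : ℝ => x + τ • w) (𝓝[>] 0) (𝓝 x) := by
    have : Continuous fun τ : ℝ => x + τ • w := by fun_prop
    simpa using (this.tendsto 0).mono_left nhdsWithin_le_nhds
  have key : ∀ ε > 0, inner ℝ v w - ε * ‖w‖ ≤ L := by
    intro ε hε
    refine ge_of_tendsto hL ?_
    filter_upwards [hpath.eventually (hv ε hε), self_mem_nhdsWithin] with τ h1 hτ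
    have hτ' : 0 < τ := hτ
    rw [add_sub_cancel_left, norm_smul, real_inner_smul_right, Real.norm_of_nonneg hτ'.le] at h1
    rw [le_div_iff₀ hτ']
    nlinarith
  have hlim : Tendsto (fun ε : ℝ => inner ℝ v w - ε * ‖w‖) (𝓝[>] 0) (𝓝 (inner ℝ v w)) := by
    have : Continuous fun ε : ℝ => (inner ℝ v w : ℝ) - ε * ‖w‖ := by fun_prop
    simpa using (this.tendsto 0).mono_left nhdsWithin_le_nhds
  exact le_of_tendsto hlim (eventually_mem_nhdsWithin.mono fun ε hε => key ε hε)

end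

lemma mem_regSubdiff_of_hasDerivWithinAt {g : ℝ → ℝ} {t u a b : ℝ}
    (ha : HasDerivWithinAt g a (Ici t) t) (hb : HasDerivWithinAt g b (Iic t) t)
    (hbu : b ≤ u) (hua : u ≤ a) : u ∈ regSubdiff (realToExt g) t := by
  rw [mem_regSubdiff_realToExt]
  intro ε hε
  have h1 := ha.isLittleO.def hε
  have h2 := hb.isLittleO.def hε
  rw [eventually_nhdsWithin_iff] at h1 h2
  filter_upwards [h1, h2] with y hy1 hy2
  have e : (inner ℝ u (y - t) : ℝ) = (y - t) * u := rfl
  rw [e, Real.norm_eq_abs]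
  rcases le_total t y with h | h
  · have := (abs_le.1 (hy1 h)).1
    simp only [smul_eq_mul, Real.norm_eq_abs] at this
    nlinarith [mul_le_mul_of_nonneg_left hua (sub_nonneg.2 h)]
  · have := (abs_le.1 (hy2 h)).1
    simp only [smul_eq_mul, Real.norm_eq_abs] at this
    nlinarith [mul_le_mul_of_nonneg_left hbu (sub_nonneg.2 h)]

lemma tendsto_ray_of_hasDerivWithinAt {g : ℝ → ℝ} {t a s : ℝ}
    (h : HasDerivWithinAt g a {y | 0 ≤ s * (y - t)} t) (hs : s * s = 1) :
    Tendsto (fun τ : ℝ => (g (t + τ • s) - g t) / τ) (𝓝[>] 0) (𝓝 (a * s)) := by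
  have hline : HasDerivWithinAt (fun τ : ℝ => t + τ • s) s (Ici 0) 0 := by
    simpa using (((hasDerivAt_id (0 : ℝ)).smul_const s).const_add t).hasDerivWithinAt
  have h' : HasDerivWithinAt g a {y | 0 ≤ s * (y - t)} (t + (0 : ℝ) • s) := by simpa using h
  have hc := HasDerivWithinAt.comp (0 : ℝ) h' hline (by
    intro τ hτ
    have : s * (t + τ • s - t) = τ := by
      simp only [smul_eq_mul]; linear_combination τ * hs
    show 0 ≤ s * (t + τ • s - t)
    rw [this]
    exact hτ)
  have h2 := (hasDerivWithinAt_iff_tendsto_slope' self_notMem_Ioi).1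
    (hc.mono Ioi_subset_Ici_self)
  refine h2.congr' ?_
  filter_upwards with τ
  simp [slope_def_field]

/-! ### The slope of a penalty on the nonnegative half-line -/

section

/-- The right derivative of a penalty on `[0, ∞)`, with the value `lam` at the origin
justified by `IsPenalty.hasDerivWithinAt`. -/
noncomputable def penaltySlope (lam : ℝ) (ρ : ℝ → ℝ) (t : ℝ) : ℝ :=
  if t = 0 then lam else deriv ρ t

variable {lam : ℝ} {ρ : ℝ → ℝ}

lemma mem_regSubdiff_iff_of_hasDerivAt {g : ℝ → ℝ} {t a u : ℝ} (h : HasDerivAt g a t) :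
    u ∈ regSubdiff (realToExt g) t ↔ u = a := by
  constructor
  · intro hu
    have h1 := inner_le_of_mem_regSubdiff hu
      (tendsto_ray_of_hasDerivWithinAt (s := 1) h.hasDerivWithinAt (by norm_num))
    have h2 := inner_le_of_mem_regSubdiff hu
      (tendsto_ray_of_hasDerivWithinAt (s := -1) h.hasDerivWithinAt (by norm_num))
    simp at h1 h2
    linarith
  · rintro rfl
    exact mem_regSubdiff_of_hasDerivWithinAt h.hasDerivWithinAt h.hasDerivWithinAt le_rfl le_rfl

lemma IsPenalty.mem_subdiff_zero_of_tendsto (h : IsPenalty lam ρ) {S : Set ℝ} (hS : (0 : ℝ) ∉ S)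
    [(𝓝[S] (0 : ℝ)).NeBot] {a : ℝ} (ha : Tendsto (deriv ρ) (𝓝[S] 0) (𝓝 a)) :
    a ∈ Icc (-lam) lam := by
  rw [← h.subdiff_zero]
  obtain ⟨y, hy⟩ := exists_seq_tendsto (𝓝[S] (0 : ℝ))
  obtain ⟨N, hN⟩ := eventually_atTop.1 (hy.eventually self_mem_nhdsWithin)
  have hy' : Tendsto (fun k => y (k + N)) atTop (𝓝[S] 0) := (tendsto_add_atTop_iff_nat N).2 hy
  refine ⟨EReal.coe_ne_top _, EReal.coe_ne_bot _, fun k => y (k + N),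
    fun k => deriv ρ (y (k + N)), hy'.mono_right nhdsWithin_le_nhds, ?_, ?_, ha.comp hy'⟩
  · have hc : Continuous (realToExt ρ) :=
      continuous_coe_real_ereal.comp h.locallyLipschitz.continuous
    exact (hc.tendsto 0).comp (hy'.mono_right nhdsWithin_le_nhds)
  · intro k
    have hne : y (k + N) ≠ 0 := fun h0 => hS (h0 ▸ hN (k + N) (by omega))
    exact (mem_regSubdiff_iff_of_hasDerivAt (h.differentiableAt _ hne).hasDerivAt).2 rfl

/-- The one-sided behaviour of a penalty at the origin. That `∂ρ(0)` is the whole interval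
`[-lam, lam]` rules out a concave kink: a subgradient different from both one-sided slopes cannot
be a limit of derivatives, hence lies between the left and the right slope. -/
lemma IsPenalty.exists_slopes_zero (h : IsPenalty lam ρ) (hlam : 0 < lam) :
    HasDerivWithinAt ρ lam (Ici 0) 0 ∧ (∃ b ≤ lam, HasDerivWithinAt ρ b (Iic 0) 0) ∧
      Tendsto (deriv ρ) (𝓝[>] 0) (𝓝 lam) ∧
      ∃ c, HasSecondOrderExpansion ρ 0 lam c c (Ici 0) := by
  obtain ⟨a, c, hE, hD, hT⟩ := h.pwtd.exists_oneSided 0 (σ := 1) (by norm_num)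
  obtain ⟨b, c', -, hD', hT'⟩ := h.pwtd.exists_oneSided 0 (σ := -1) (by norm_num)
  have s1 : {u : ℝ | 0 ≤ (1 : ℝ) * u} = Ici 0 := by ext; simp
  have s2 : {y : ℝ | 0 ≤ (1 : ℝ) * (y - 0)} = Ici 0 := by ext; simp
  have s3 : {y : ℝ | 0 < (1 : ℝ) * (y - 0)} = Ioi 0 := by ext; simp
  have s4 : {y : ℝ | 0 ≤ (-1 : ℝ) * (y - 0)} = Iic 0 := by ext; simp
  have s5 : {y : ℝ | 0 < (-1 : ℝ) * (y - 0)} = Iio 0 := by ext; simp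
  have hra := tendsto_ray_of_hasDerivWithinAt hD (by norm_num)
  have hrb := tendsto_ray_of_hasDerivWithinAt hD' (by norm_num)
  rw [s1] at hE
  rw [s2] at hD
  rw [s3] at hT
  rw [s4] at hD'
  rw [s5] at hT'
  have ha := h.mem_subdiff_zero_of_tendsto (by simp) hT
  have hb := h.mem_subdiff_zero_of_tendsto (by simp) hT'
  have key : ∀ u ∈ Ioo (-lam) lam, u ≠ a → u ≠ b → u ≤ a := by
    intro u hu hua hub
    have hmem : u ∈ subdiff (realToExt ρ) 0 := by
      rw [h.subdiff_zero]; exact Ioo_subset_Icc_self hu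
    obtain ⟨-, -, y, w, hy, -, hw, hwu⟩ := hmem
    -- Away from the origin `w k` is a derivative, which near the origin is close to `a` or `b`.
    have hfreq : ∃ᶠ k in atTop, y k = 0 := by
      intro hne
      have hda : Tendsto (fun k => deriv ρ (y k) - w k) atTop (𝓝 0) := by
        refine tendsto_const_nhds.congr' ?_
        filter_upwards [hne] with k hk
        rw [(mem_regSubdiff_iff_of_hasDerivAt (h.differentiableAt _ hk).hasDerivAt).1 (hw k),
          sub_self]
      have hdu : Tendsto (fun k => deriv ρ (y k)) atTop (𝓝 u) := by
        simpa using hda.add hwu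
      have h1 : ∀ᶠ k in atTop, deriv ρ (y k) ∈ ({a, b} : Set ℝ)ᶜ := hdu.eventually
        ((Set.toFinite ({a, b} : Set ℝ)).isClosed.isOpen_compl.mem_nhds (by simp [hua, hub]))
      obtain ⟨U, V, hU, hV, haU, huV, hUV⟩ := t2_separation (Ne.symm hua)
      obtain ⟨U', V', hU', hV', hbU, huV', hUV'⟩ := t2_separation (Ne.symm hub)
      have e1 := eventually_nhdsWithin_iff.1 (hT.eventually (hU.mem_nhds haU))
      have e2 := eventually_nhdsWithin_iff.1 (hT'.eventually (hU'.mem_nhds hbU))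
      obtain ⟨k, hk, k1, k2, k3, k4⟩ := (hne.and ((hy.eventually e1).and ((hy.eventually e2).and
        ((hdu.eventually (hV.mem_nhds huV)).and (hdu.eventually (hV'.mem_nhds huV')))))).exists
      rcases lt_or_gt_of_ne hk with h0 | h0
      · exact disjoint_left.1 hUV' (k2 h0) k4
      · exact disjoint_left.1 hUV (k1 h0) k3
    refine isClosed_Iic.mem_of_frequently_of_tendsto (hfreq.mono fun k hk => ?_) hwu
    have hk' := hw k
    rw [hk] at hk'
    simpa using inner_le_of_mem_regSubdiff hk' hra
  have hal : a = lam := by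
    refine le_antisymm ha.2 (not_lt.1 fun hlt => ?_)
    -- Of two points between `a` and `lam`, at least one differs from `b` and contradicts `key`.
    obtain ⟨u, hu1, hu2⟩ := exists_between hlt
    obtain ⟨u', hu1', hu2'⟩ := exists_between hu2
    have n1 : u = b := by
      by_contra hne
      exact absurd (key u ⟨ha.1.trans_lt hu1, hu2⟩ hu1.ne' hne) (not_le.2 hu1)
    have hu3 := hu1.trans hu1'
    exact absurd (key u' ⟨ha.1.trans_lt hu3, hu2'⟩ hu3.ne' (n1 ▸ hu1'.ne')) (not_le.2 hu3)
  subst hal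
  exact ⟨hD, ⟨b, hb.2, hD'⟩, hT, c, hE⟩

lemma IsPenalty.continuousAt_deriv_and_expansion (h : IsPenalty lam ρ) {t : ℝ} (ht : t ≠ 0) :
    ContinuousAt (deriv ρ) t ∧
      ∃ cp cm, HasSecondOrderExpansion ρ t (deriv ρ t) cp cm univ := by
  obtain ⟨a, c, hE, hD, hT⟩ := h.pwtd.exists_oneSided t (σ := 1) (by norm_num)
  obtain ⟨b, c', hE', hD', hT'⟩ := h.pwtd.exists_oneSided t (σ := -1) (by norm_num)
  have s1 : {u : ℝ | 0 ≤ (1 : ℝ) * u} = Ici 0 := by ext; simp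
  have s1' : {u : ℝ | 0 ≤ (-1 : ℝ) * u} = Iic 0 := by ext; simp
  have s2 : {y : ℝ | 0 ≤ (1 : ℝ) * (y - t)} = Ici t := by ext; simp
  have s3 : {y : ℝ | 0 < (1 : ℝ) * (y - t)} = Ioi t := by ext; simp
  have s4 : {y : ℝ | 0 ≤ (-1 : ℝ) * (y - t)} = Iic t := by ext; simp
  have s5 : {y : ℝ | 0 < (-1 : ℝ) * (y - t)} = Iio t := by ext; simp
  rw [s1] at hE
  rw [s1'] at hE'
  rw [s2] at hD
  rw [s3] at hT
  rw [s4] at hD'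
  rw [s5] at hT'
  have hd := (h.differentiableAt t ht).hasDerivAt
  have ea : a = deriv ρ t :=
    (uniqueDiffOn_Ici t t self_mem_Ici).eq_deriv _ hD hd.hasDerivWithinAt
  have eb : b = deriv ρ t :=
    (uniqueDiffOn_Iic t t self_mem_Iic).eq_deriv _ hD' hd.hasDerivWithinAt
  subst ea
  rw [eb] at hE' hT'
  refine ⟨?_, c, c', ?_⟩
  · rw [continuousAt_iff_punctured_nhds, ← Iio_union_Ioi, nhdsWithin_union]
    exact hT'.sup hT
  · intro ε hε
    rw [← Iic_union_Ici (a := (0 : ℝ)), nhdsWithin_union, eventually_sup]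
    constructor
    · filter_upwards [hE' ε hε, self_mem_nhdsWithin] with u hu hu0
      have hu0' : u ≤ 0 := hu0
      simpa [hu0'] using hu
    · filter_upwards [hE ε hε, self_mem_nhdsWithin] with u hu hu0
      have hu0' : 0 ≤ u := hu0
      simpa [hu0'] using hu

lemma penaltySlope_zero : penaltySlope lam ρ 0 = lam := if_pos rfl

lemma penaltySlope_of_ne {t : ℝ} (ht : t ≠ 0) : penaltySlope lam ρ t = deriv ρ t := if_neg ht

lemma IsPenalty.hasDerivWithinAt (h : IsPenalty lam ρ) (hlam : 0 < lam) (t : ℝ) :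
    HasDerivWithinAt ρ (penaltySlope lam ρ t) (Ici t) t := by
  rcases eq_or_ne t 0 with rfl | ht
  · rw [penaltySlope_zero]; exact (h.exists_slopes_zero hlam).1
  · rw [penaltySlope_of_ne ht]; exact (h.differentiableAt t ht).hasDerivAt.hasDerivWithinAt

lemma IsPenalty.hasDerivWithinAt_Ici_zero (h : IsPenalty lam ρ) (hlam : 0 < lam) {t : ℝ}
    (ht : 0 ≤ t) : HasDerivWithinAt ρ (penaltySlope lam ρ t) (Ici 0) t := by
  rcases ht.eq_or_lt with rfl | ht
  · exact h.hasDerivWithinAt hlam 0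
  · rw [penaltySlope_of_ne ht.ne']
    exact (h.differentiableAt t ht.ne').hasDerivAt.hasDerivWithinAt

lemma IsPenalty.continuousOn_slope (h : IsPenalty lam ρ) (hlam : 0 < lam) :
    ContinuousOn (penaltySlope lam ρ) (Ici 0) := by
  intro t ht
  rcases eq_or_lt_of_le (show (0 : ℝ) ≤ t from ht) with rfl | ht
  · rw [← continuousWithinAt_Ioi_iff_Ici, ContinuousWithinAt, penaltySlope_zero]
    refine (h.exists_slopes_zero hlam).2.2.1.congr' ?_
    filter_upwards [self_mem_nhdsWithin] with u hu
    exact (penaltySlope_of_ne (ne_of_gt hu)).symm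
  · refine ContinuousAt.continuousWithinAt ?_
    refine (h.continuousAt_deriv_and_expansion ht.ne').1.congr ?_
    filter_upwards [isOpen_ne.mem_nhds ht.ne'] with u hu
    exact (penaltySlope_of_ne hu).symm

/-- The second-order expansion of a penalty at a point of `[0, ∞)`, for increments that stay
in `[0, ∞)`. -/
lemma IsPenalty.exists_expansion (h : IsPenalty lam ρ) (hlam : 0 < lam) {t : ℝ} (ht : 0 ≤ t) :
    ∃ cp cm, HasSecondOrderExpansion ρ t (penaltySlope lam ρ t) cp cm {u | 0 ≤ t + u} := by
  rcases ht.eq_or_lt with rfl | ht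
  · obtain ⟨c, hc⟩ := (h.exists_slopes_zero hlam).2.2.2
    refine ⟨c, c, ?_⟩
    simp only [zero_add, penaltySlope_zero]
    exact hc
  · obtain ⟨cp, cm, hc⟩ := (h.continuousAt_deriv_and_expansion ht.ne').2
    refine ⟨cp, cm, fun ε hε => ?_⟩
    rw [penaltySlope_of_ne ht.ne']
    exact (hc ε hε).filter_mono (nhdsWithin_mono _ (subset_univ _))

end

/-! ### Lower epi-limits attained along a recovery filter -/

section

variable {E : Type*} [NormedAddCommGroup E]

/-- The filter of pairs `(τ, w')` with `τ ↓ 0` and `w' → w`. -/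
def dirFilter (w : E) : Filter (ℝ × E) := 𝓝[>] (0 : ℝ) ×ˢ 𝓝 w

/-- The filter of pairs `(τ, w)` with `τ ↓ 0` and a fixed direction `w`. -/
def rayFilter (w : E) : Filter (ℝ × E) := map (fun τ : ℝ => (τ, w)) (𝓝[>] 0)

/-- The filter of pairs `(τ, w + (τ / 2) z')` with `τ ↓ 0` and `z' → z`; since
`τ (w + (τ / 2) z') = τ w + (τ² / 2) z'`, it turns second-order difference quotients into
parabolic ones. -/
noncomputable def parabolicFilter [NormedSpace ℝ E] (w z : E) : Filter (ℝ × E) :=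
  map (fun p : ℝ × E => (p.1, w + (p.1 / 2) • p.2)) (dirFilter z)

/-- `L` is a lower bound, different from `-∞`, for the values of `U` along all `(τ, w')` with
`τ ↓ 0` and `w' → w`, and it is the limit of `U` along the recovery filter `l`. -/
def EpiLimAt (U : ℝ × E → ℝ) (w : E) (l : Filter (ℝ × E)) (L : EReal) : Prop :=
  L ≠ ⊥ ∧ L ≤ liminf (fun p => (U p : EReal)) (dirFilter w) ∧
    Tendsto (fun p => (U p : EReal)) l (𝓝 L)

instance (w : E) : (dirFilter w).NeBot := by unfold dirFilter; infer_instance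

instance (w : E) : (rayFilter w).NeBot := by unfold rayFilter; infer_instance

instance [NormedSpace ℝ E] (w z : E) : (parabolicFilter w z).NeBot := by unfold parabolicFilter; infer_instance

lemma tendsto_fst_dirFilter (w : E) : Tendsto Prod.fst (dirFilter w) (𝓝[>] (0 : ℝ)) :=
  tendsto_fst

lemma tendsto_snd_dirFilter (w : E) : Tendsto Prod.snd (dirFilter w) (𝓝 w) := tendsto_snd

lemma eventually_pos_dirFilter (w : E) : ∀ᶠ p in dirFilter w, 0 < p.1 :=
  (tendsto_fst_dirFilter w).eventually self_mem_nhdsWithin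

lemma tendsto_fst_dirFilter_zero (w : E) : Tendsto Prod.fst (dirFilter w) (𝓝 (0 : ℝ)) :=
  (tendsto_fst_dirFilter w).mono_right nhdsWithin_le_nhds

lemma tendsto_step_dirFilter [NormedSpace ℝ E] (x w : E) :
    Tendsto (fun p : ℝ × E => x + p.1 • p.2) (dirFilter w) (𝓝 x) := by
  simpa using tendsto_const_nhds.add
    ((tendsto_fst_dirFilter_zero w).smul (tendsto_snd_dirFilter w))

lemma rayFilter_le (w : E) : rayFilter w ≤ dirFilter w :=
  tendsto_id.prodMk tendsto_const_nhds

lemma tendsto_parabolic [NormedSpace ℝ E] (w z : E) :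
    Tendsto (fun p : ℝ × E => (p.1, w + (p.1 / 2) • p.2)) (dirFilter z) (dirFilter w) := by
  refine (tendsto_fst_dirFilter z).prodMk ?_
  have h := ((tendsto_fst_dirFilter_zero z).div_const 2).smul (tendsto_snd_dirFilter z)
  simpa using tendsto_const_nhds.add h

lemma parabolicFilter_le [NormedSpace ℝ E] (w z : E) : parabolicFilter w z ≤ dirFilter w := tendsto_parabolic w z

lemma rayFilter_le_parabolicFilter [NormedSpace ℝ E] (w : E) : rayFilter w ≤ parabolicFilter w 0 := by
  have h : rayFilter w = map (fun p : ℝ × E => (p.1, w + (p.1 / 2) • p.2)) (rayFilter 0) := by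
    simp [rayFilter, Filter.map_map, Function.comp_def]
  rw [h]
  exact map_mono (rayFilter_le 0)

variable {U V : ℝ × E → ℝ} {w : E} {l : Filter (ℝ × E)} {L M : EReal}

lemma EpiLimAt.mono (h : EpiLimAt U w l L) {l' : Filter (ℝ × E)} (hl : l' ≤ l) :
    EpiLimAt U w l' L := ⟨h.1, h.2.1, h.2.2.mono_left hl⟩

lemma EpiLimAt.of_tendsto (hl : l ≤ dirFilter w) {c : ℝ} (h : Tendsto U (dirFilter w) (𝓝 c)) :
    EpiLimAt U w l c := by
  have h' : Tendsto (fun p => (U p : EReal)) (dirFilter w) (𝓝 (c : EReal)) :=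
    (continuous_coe_real_ereal.tendsto c).comp h
  exact ⟨EReal.coe_ne_bot c, h'.liminf_eq.ge, h'.mono_left hl⟩

lemma EpiLimAt.of_tendsto_atTop (hl : l ≤ dirFilter w) (h : Tendsto U (dirFilter w) atTop) :
    EpiLimAt U w l ⊤ := by
  have h' : Tendsto (fun p => (U p : EReal)) (dirFilter w) (𝓝 ⊤) :=
    EReal.tendsto_coe_atTop.comp h
  exact ⟨bot_ne_top.symm, h'.liminf_eq.ge, h'.mono_left hl⟩

lemma EpiLimAt.of_nonneg (h0 : ∀ᶠ p in dirFilter w, 0 ≤ U p) (h : Tendsto U l (𝓝 0)) :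
    EpiLimAt U w l 0 := by
  refine ⟨EReal.zero_ne_bot, le_liminf_of_le (h := ?_), ?_⟩
  · filter_upwards [h0] with p hp
    exact_mod_cast hp
  · exact (continuous_coe_real_ereal.tendsto 0).comp h

lemma EpiLimAt.congr (h : EpiLimAt U w l L) (hl : l ≤ dirFilter w)
    (hUV : ∀ᶠ p in dirFilter w, U p = V p) : EpiLimAt V w l L := by
  have hUV' : ∀ᶠ p in dirFilter w, (U p : EReal) = (V p : EReal) :=
    hUV.mono fun p hp => by rw [hp]
  refine ⟨h.1, ?_, h.2.2.congr' (hl hUV')⟩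
  rw [← liminf_congr hUV']
  exact h.2.1

lemma EpiLimAt.add (hU : EpiLimAt U w l L) (hV : EpiLimAt V w l M) :
    EpiLimAt (fun p => U p + V p) w l (L + M) := by
  refine ⟨by simp [EReal.add_eq_bot_iff, hU.1, hV.1], ?_, ?_⟩
  · simp only [EReal.coe_add]
    exact (add_le_add hU.2.1 hV.2.1).trans EReal.le_liminf_add
  · simp only [EReal.coe_add]
    exact (EReal.continuousAt_add (p := (L, M)) (Or.inr hV.1) (Or.inl hU.1)).tendsto.comp
      (hU.2.2.prodMk_nhds hV.2.2)

lemma EpiLimAt.sum {ι : Type*} (s : Finset ι) {U : ι → ℝ × E → ℝ} {L : ι → EReal}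
    (hl : l ≤ dirFilter w) (h : ∀ i ∈ s, EpiLimAt (U i) w l (L i)) :
    EpiLimAt (fun p => ∑ i ∈ s, U i p) w l (∑ i ∈ s, L i) := by
  classical
  induction s using Finset.induction_on with
  | empty => simpa using EpiLimAt.of_tendsto hl (c := 0) tendsto_const_nhds
  | insert i s hi ih =>
    simp only [Finset.sum_insert hi]
    exact (h i (Finset.mem_insert_self i s)).add
      (ih fun k hk => h k (Finset.mem_insert_of_mem hk))

lemma EpiLimAt.const_mul (hl : l ≤ dirFilter w) (h : EpiLimAt U w l L) {c : ℝ} (hc : 0 ≤ c) :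
    EpiLimAt (fun p => c * U p) w l ((c : EReal) * L) := by
  rcases hc.eq_or_lt with rfl | hc
  · simpa using EpiLimAt.of_tendsto hl (c := 0) tendsto_const_nhds
  have hc' : (0 : EReal) < (c : EReal) := by exact_mod_cast hc
  refine ⟨?_, ?_, ?_⟩
  · have := h.1
    induction L with
    | bot => exact absurd rfl this
    | coe L => rw [← EReal.coe_mul]; exact EReal.coe_ne_bot _
    | top => rw [EReal.coe_mul_top_of_pos hc]; exact bot_ne_top.symm
  · simp only [EReal.coe_mul]
    rw [show (fun p => (c : EReal) * (U p : EReal)) = (fun _ => (c : EReal)) * fun p => (U p : EReal)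
      from rfl]
    have := EReal.liminf_const_mul_of_nonneg_of_ne_top (f := dirFilter w)
      (u := fun p => (U p : EReal)) hc'.le (EReal.coe_ne_top c)
    refine le_trans (mul_le_mul_of_nonneg_left h.2.1 hc'.le) this.ge
  · simp only [EReal.coe_mul]
    exact (EReal.continuousAt_mul (p := ((c : EReal), L)) (Or.inl hc'.ne') (Or.inl hc'.ne')
      (Or.inl (EReal.coe_ne_bot c)) (Or.inl (EReal.coe_ne_top c))).tendsto.comp
      (tendsto_const_nhds.prodMk_nhds h.2.2)

lemma EpiLimAt.liminf_eq [l.NeBot] (h : EpiLimAt U w l L) (hl : l ≤ dirFilter w) :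
    liminf (fun p => (U p : EReal)) (dirFilter w) = L :=
  le_antisymm ((liminf_le_liminf_of_le hl).trans_eq h.2.2.liminf_eq) h.2.1

end

/-! ### Subderivatives of real-valued functions as limits of real quotients -/

section

variable {E : Type*} [NormedAddCommGroup E] [InnerProductSpace ℝ E]

lemma subderiv_realToExt {g : E → ℝ} {x w : E} {D : ℝ}
    (h : Tendsto (quot g x) (dirFilter w) (𝓝 D)) : subderiv (realToExt g) x w = (D : EReal) := by
  have h' : Tendsto (fun p => ((quot g x p : ℝ) : EReal)) (dirFilter w) (𝓝 (D : EReal)) :=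
    (continuous_coe_real_ereal.tendsto D).comp h
  rw [← h'.liminf_eq]
  simp only [subderiv, realToExt, quot, dirFilter, EReal.coe_div, EReal.coe_sub]

lemma semideriv_eq {g : E → ℝ} {x w : E} {D : ℝ}
    (h : Tendsto (quot g x) (dirFilter w) (𝓝 D)) : semideriv g x w = D :=
  Tendsto.limUnder_eq h

/-- The real second-order difference quotient of `g` at `x` with first-order term `D w'`. -/
noncomputable def secondOrderQuot (g : E → ℝ) (x : E) (D : E → ℝ) (p : ℝ × E) : ℝ :=
  (g (x + p.1 • p.2) - g x - p.1 * D p.2) / (p.1 ^ 2 / 2)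

lemma secondQuotFor_realToExt (g : E → ℝ) (x v : E) (τ : ℝ) (w : E) :
    secondQuotFor (realToExt g) x v τ w
      = (secondOrderQuot g x (fun w' => inner ℝ v w') (τ, w) : EReal) := by
  simp only [secondQuotFor, realToExt, secondOrderQuot, EReal.coe_div, EReal.coe_sub]

lemma secondSubderivFor_realToExt (g : E → ℝ) (x v w : E) :
    secondSubderivFor (realToExt g) x v w
      = liminf (fun p => (secondOrderQuot g x (fun w' => inner ℝ v w') p : EReal))
        (dirFilter w) := by
  simp only [secondSubderivFor, secondQuotFor_realToExt, dirFilter]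

lemma secondSubderiv_realToExt {g : E → ℝ} {x : E} {D : E → ℝ}
    (h : ∀ w, Tendsto (quot g x) (dirFilter w) (𝓝 (D w))) (w : E) :
    secondSubderiv (realToExt g) x w
      = liminf (fun p => (secondOrderQuot g x D p : EReal)) (dirFilter w) := by
  have hq : ∀ p : ℝ × E, secondQuot (realToExt g) x p.1 p.2
      = (secondOrderQuot g x D p : EReal) := by
    intro p
    rw [secondQuot, subderiv_realToExt (h p.2), if_neg (by simp [realToExt])]
    simp only [realToExt, secondOrderQuot, EReal.coe_div, EReal.coe_sub, EReal.coe_mul]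
  simp only [secondSubderiv, hq, dirFilter]

/-- The parabolic quotient at `z'` is the second-order quotient at `w + (τ / 2) z'` plus a
difference quotient of the first-order term. -/
lemma secondOrderQuot_parabolic {g : E → ℝ} {x w : E} {D : E → ℝ} (p : ℝ × E) (hp : 0 < p.1) :
    (g (x + p.1 • w + (p.1 ^ 2 / 2) • p.2) - g x - p.1 * D w) / (p.1 ^ 2 / 2)
      = secondOrderQuot g x D (p.1, w + (p.1 / 2) • p.2)
        + (D (w + (p.1 / 2) • p.2) - D w) / (p.1 / 2) := by
  have e : x + p.1 • w + (p.1 ^ 2 / 2) • p.2 = x + p.1 • (w + (p.1 / 2) • p.2) := by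
    rw [smul_add, smul_smul, add_assoc]
    congr 3
    ring
  rw [e, secondOrderQuot]
  field_simp
  ring

/-! ### Second-order properties from recovery along rays -/

/-- If the second-order difference quotients converge along every fixed direction to their lower
epi-limit, then `g` is properly twice epi-differentiable. -/
lemma properlyTwiceEpiDifferentiableAt_of_epiLimAt {g : E → ℝ} {x v : E}
    (h : ∀ w, ∃ L, EpiLimAt (secondOrderQuot g x fun w' => inner ℝ v w') w (rayFilter w) L) :
    ProperlyTwiceEpiDifferentiableAt (realToExt g) x v := by
  have h' : ∀ w, EpiLimAt (secondOrderQuot g x fun w' => inner ℝ v w') w (rayFilter w)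
      (secondSubderivFor (realToExt g) x v w) := by
    intro w
    obtain ⟨L, hL⟩ := h w
    rwa [secondSubderivFor_realToExt, hL.liminf_eq (rayFilter_le w)]
  set H := fun τ : ℝ => secondQuotFor (realToExt g) x v τ with hH
  set d := secondSubderivFor (realToExt g) x v with hd
  have hpt : ∀ w, Tendsto (fun τ => H τ w) (𝓝[>] 0) (𝓝 (d w)) := by
    intro w
    have := (h' w).2.2
    rw [rayFilter, tendsto_map'_iff] at this
    simp only [hH, secondQuotFor_realToExt]
    exact this
  have hfin : ∀ τ w, H τ w ≠ ⊤ ∧ H τ w ≠ ⊥ := by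
    intro τ w
    simp only [hH, secondQuotFor_realToExt]
    exact ⟨EReal.coe_ne_top _, EReal.coe_ne_bot _⟩
  have hinner : epigraph d ⊆ innerLimit (fun t => epigraph (H t)) (𝓝[>] 0) := by
    rintro ⟨w, α⟩ hα W hW
    have hα' : d w ≤ (α : EReal) := hα
    have ht : Tendsto (fun τ => max (α : EReal) (H τ w)) (𝓝[>] 0) (𝓝 (α : EReal)) := by
      simpa [max_eq_left hα'] using (tendsto_const_nhds (x := (α : EReal))).max (hpt w)
    have ht' : Tendsto (fun τ => (max (α : EReal) (H τ w)).toReal) (𝓝[>] 0) (𝓝 α) := by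
      exact (EReal.tendsto_toReal (EReal.coe_ne_top α) (EReal.coe_ne_bot α)).comp ht
    have ht'' : Tendsto (fun τ => (w, (max (α : EReal) (H τ w)).toReal)) (𝓝[>] 0) (𝓝 (w, α)) :=
      tendsto_const_nhds.prodMk_nhds ht'
    filter_upwards [ht''.eventually hW] with τ hτ
    refine ⟨_, ?_, hτ⟩
    show H τ w ≤ (((max (α : EReal) (H τ w)).toReal : ℝ) : EReal)
    rw [EReal.coe_toReal]
    · exact le_max_right _ _
    · rcases max_choice (α : EReal) (H τ w) with e | e <;> rw [e]
      · exact EReal.coe_ne_top α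
      · exact (hfin τ w).1
    · rcases max_choice (α : EReal) (H τ w) with e | e <;> rw [e]
      · exact EReal.coe_ne_bot α
      · exact (hfin τ w).2
  have hio : innerLimit (fun t => epigraph (H t)) (𝓝[>] 0)
      ⊆ outerLimit (fun t => epigraph (H t)) (𝓝[>] 0) := fun p hp W hW => (hp W hW).frequently
  have houter : outerLimit (fun t => epigraph (H t)) (𝓝[>] 0) ⊆ epigraph d := by
    rintro ⟨w, α⟩ hout
    by_contra hcon
    have hlt : (α : EReal) < d w := not_le.1 hcon
    obtain ⟨c, hc1, hc2⟩ := EReal.lt_iff_exists_real_btwn.1 hlt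
    have hev : ∀ᶠ p in dirFilter w, (c : EReal) < H p.1 p.2 := by
      have := eventually_lt_of_lt_liminf (hc2.trans_le (h' w).2.1)
      simpa only [hH, secondQuotFor_realToExt] using this
    obtain ⟨pa, hpa, pb, hpb, hab⟩ := eventually_prod_iff.1 hev
    have hW : {w' | pb w'} ×ˢ Iio c ∈ 𝓝 (w, α) :=
      prod_mem_nhds hpb (Iio_mem_nhds (EReal.coe_lt_coe_iff.1 hc1))
    obtain ⟨τ, ⟨⟨w', α'⟩, h1, h2, h3⟩, hτ⟩ := ((hout _ hW).and_eventually hpa).exists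
    have h4 : (c : EReal) < H τ w' := hab hτ h2
    have h5 : H τ w' ≤ (α' : EReal) := h1
    exact absurd (EReal.coe_lt_coe_iff.1 (h4.trans_le h5)) (not_lt.2 (le_of_lt h3))
  refine ⟨⟨(hinner.trans hio).antisymm houter, hinner.antisymm (hio.trans houter)⟩,
    fun w => (h' w).1, 0, ?_⟩
  have h0 : d 0 = 0 := by
    refine tendsto_nhds_unique (hpt 0) ?_
    simp [hH, secondQuotFor_realToExt, secondOrderQuot]
  show d 0 < ⊤
  rw [h0]
  exact EReal.zero_lt_top

/-- If the second-order difference quotients converge along every fixed direction to their lower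
epi-limit, then `g` is parabolically regular: the parabolic quotients are the second-order
quotients at `w + (τ / 2) z'`, up to the term `⟨v, z'⟩`, and the choice `z = 0` is optimal. -/
lemma parabolicallyRegularAt_of_epiLimAt {g : E → ℝ} {x v : E}
    (h : ∀ w, ∃ L, EpiLimAt (secondOrderQuot g x fun w' => inner ℝ v w') w (rayFilter w) L) :
    ParabolicallyRegularAt (realToExt g) x v := by
  refine ⟨EReal.coe_ne_top _, EReal.coe_ne_bot _, fun w hw => ?_⟩
  obtain ⟨L, hL⟩ := h w
  rw [secondSubderivFor_realToExt, hL.liminf_eq (rayFilter_le w)]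
  set Q := secondOrderQuot g x fun w' => inner ℝ v w' with hQ
  have hps : ∀ z, parabolicSubderiv (realToExt g) x w z = liminf (fun p : ℝ × E =>
      ((Q (p.1, w + (p.1 / 2) • p.2) + inner ℝ v p.2 : ℝ) : EReal)) (dirFilter z) := by
    intro z
    refine liminf_congr ?_
    filter_upwards [eventually_pos_dirFilter z] with p hp
    rw [hw]
    simp only [realToExt]
    rw [← EReal.coe_mul, ← EReal.coe_sub, ← EReal.coe_sub, ← EReal.coe_div,
      secondOrderQuot_parabolic (D := fun w' => inner ℝ v w') p hp]
    congr 2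
    rw [← inner_sub_right, add_sub_cancel_left, real_inner_smul_right]
    field_simp
  apply le_antisymm
  · refine (iInf_le _ 0).trans ?_
    rw [hps, inner_zero_right, EReal.coe_zero, sub_zero]
    refine (liminf_le_liminf_of_le (rayFilter_le 0)).trans_eq (Tendsto.liminf_eq ?_)
    have := hL.2.2
    rw [rayFilter, tendsto_map'_iff] at this ⊢
    simpa [Function.comp_def] using this
  · refine le_iInf fun z => ?_
    rw [EReal.le_sub_iff_add_le (Or.inl (EReal.coe_ne_bot _)) (Or.inl (EReal.coe_ne_top _)), hps]
    have h1 : L ≤ liminf (fun p : ℝ × E => ((Q (p.1, w + (p.1 / 2) • p.2) : ℝ) : EReal))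
        (dirFilter z) :=
      hL.2.1.trans (liminf_le_liminf_of_le (tendsto_parabolic w z))
    have h2 : Tendsto (fun p : ℝ × E => ((inner ℝ v p.2 : ℝ) : EReal)) (dirFilter z)
        (𝓝 ((inner ℝ v z : ℝ) : EReal)) :=
      (continuous_coe_real_ereal.tendsto _).comp
        (tendsto_const_nhds.inner (tendsto_snd_dirFilter z))
    rw [← h2.liminf_eq]
    simp only [EReal.coe_add]
    exact (add_le_add h1 le_rfl).trans EReal.le_liminf_add

end

/-! ### First-order behaviour of a block norm -/

section

variable {n : ℕ}

/-- The power sum `∑ |x_j|^q` over a block. -/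
noncomputable def blockPow (q : ℝ) (J : Finset (Fin n)) (x : EuclideanSpace ℝ (Fin n)) : ℝ :=
  ∑ j ∈ J, |x j| ^ q

/-- The `q`-norm of the block `x_J`, as a function of the whole vector `x`. -/
noncomputable def blockNorm (q : ℝ) (J : Finset (Fin n)) (x : EuclideanSpace ℝ (Fin n)) : ℝ :=
  blockPow q J x ^ (1 / q)

/-- The semiderivative of the block norm: its derivative where `x_J ≠ 0`, and the block norm
itself where `x_J = 0`. -/
noncomputable def blockNormDir (q : ℝ) (J : Finset (Fin n)) (x w : EuclideanSpace ℝ (Fin n)) : ℝ :=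
  if blockNorm q J x = 0 then blockNorm q J w else fderiv ℝ (blockNorm q J) x w

variable {q : ℝ} {J : Finset (Fin n)} {x y w z : EuclideanSpace ℝ (Fin n)}

lemma blockPow_nonneg : 0 ≤ blockPow q J x :=
  Finset.sum_nonneg fun _ _ => Real.rpow_nonneg (abs_nonneg _) _

lemma blockNorm_nonneg : 0 ≤ blockNorm q J x := Real.rpow_nonneg blockPow_nonneg _

lemma blockPow_pos (hq : 1 < q) (hx : blockNorm q J x ≠ 0) : 0 < blockPow q J x := by
  refine lt_of_le_of_ne blockPow_nonneg fun h => hx ?_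
  rw [blockNorm, ← h, Real.zero_rpow]
  positivity

lemma eq_zero_of_blockNorm_eq_zero (hx : blockNorm q J x = 0) (hq : 1 < q) :
    ∀ j ∈ J, x j = 0 := by
  rw [blockNorm, Real.rpow_eq_zero blockPow_nonneg (by positivity), blockPow,
    Finset.sum_eq_zero_iff_of_nonneg fun _ _ => Real.rpow_nonneg (abs_nonneg _) _] at hx
  intro j hj
  have := hx j hj
  rwa [Real.rpow_eq_zero (abs_nonneg _) (by positivity), abs_eq_zero] at this

lemma blockNorm_congr (h : ∀ j ∈ J, x j = y j) : blockNorm q J x = blockNorm q J y := by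
  rw [blockNorm, blockNorm, blockPow, blockPow, Finset.sum_congr rfl fun j hj => by rw [h j hj]]

lemma blockNorm_smul (hq : 1 < q) {c : ℝ} (hc : 0 ≤ c) :
    blockNorm q J (c • x) = c * blockNorm q J x := by
  have hq0 : q ≠ 0 := by positivity
  have : blockPow q J (c • x) = c ^ q * blockPow q J x := by
    rw [blockPow, blockPow, Finset.mul_sum]
    refine Finset.sum_congr rfl fun j _ => ?_
    rw [PiLp.smul_apply, smul_eq_mul, abs_mul, abs_of_nonneg hc,
      Real.mul_rpow hc (abs_nonneg _)]
  rw [blockNorm, this, Real.mul_rpow (Real.rpow_nonneg hc _) blockPow_nonneg,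
    ← Real.rpow_mul hc, mul_one_div_cancel hq0, Real.rpow_one, blockNorm]

lemma blockNorm_add_le (hq : 1 < q) :
    blockNorm q J (x + y) ≤ blockNorm q J x + blockNorm q J y := by
  simpa only [blockNorm, blockPow, PiLp.add_apply] using
    Real.Lp_add_le J (fun j => x j) (fun j => y j) hq.le

lemma blockNorm_zero (hq : 1 < q) : blockNorm q J 0 = 0 := by
  simpa using blockNorm_smul (J := J) (x := 0) hq le_rfl

lemma contDiff_blockPow (hq : 1 < q) : ContDiff ℝ 1 (blockPow q J) := by
  unfold blockPow
  refine ContDiff.sum fun j _ => ?_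
  exact (contDiff_norm_rpow (E := ℝ) hq).comp (EuclideanSpace.proj (𝕜 := ℝ) j).contDiff

lemma continuous_blockNorm (hq : 1 < q) : Continuous (blockNorm q J) :=
  (contDiff_blockPow hq).continuous.rpow_const fun _ => Or.inr (by positivity)

lemma contDiffAt_blockNorm (hq : 1 < q) (hx : blockNorm q J x ≠ 0) :
    ContDiffAt ℝ 1 (blockNorm q J) x :=
  (contDiff_blockPow hq).contDiffAt.rpow_const_of_ne (blockPow_pos hq hx).ne'

lemma tendsto_quot_of_hasFDerivAt {E : Type*} [NormedAddCommGroup E] [InnerProductSpace ℝ E]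
    {g : E → ℝ} {g' : E →L[ℝ] ℝ} {x : E} (h : HasFDerivAt g g' x) (w : E) :
    Tendsto (quot g x) (dirFilter w) (𝓝 (g' w)) := by
  have h0 : Tendsto (fun p : ℝ × E => p.1 • p.2) (dirFilter w) (𝓝 0) := by
    simpa using tendsto_step_dirFilter 0 w
  have := h.hasFDerivWithinAt.lim (c := fun p : ℝ × E => p.1⁻¹) h0
    (Eventually.of_forall fun _ => mem_univ _) (v := w) (by
      refine (tendsto_snd_dirFilter w).congr' ?_
      filter_upwards [eventually_pos_dirFilter w] with p hp
      rw [smul_smul, inv_mul_cancel₀ hp.ne', one_smul])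
  refine this.congr fun p => ?_
  rw [quot, smul_eq_mul, div_eq_inv_mul]

lemma blockNorm_step (hq : 1 < q) (hx : blockNorm q J x = 0) {τ : ℝ} (hτ : 0 ≤ τ) :
    blockNorm q J (x + τ • w) = τ * blockNorm q J w := by
  rw [← blockNorm_smul hq hτ]
  refine blockNorm_congr fun j hj => ?_
  rw [PiLp.add_apply, eq_zero_of_blockNorm_eq_zero hx hq j hj, zero_add]

lemma tendsto_quot_blockNorm (hq : 1 < q) (x w : EuclideanSpace ℝ (Fin n)) :
    Tendsto (quot (blockNorm q J) x) (dirFilter w) (𝓝 (blockNormDir q J x w)) := by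
  by_cases hx : blockNorm q J x = 0
  · rw [blockNormDir, if_pos hx]
    refine (((continuous_blockNorm hq).tendsto w).comp (tendsto_snd_dirFilter w)).congr' ?_
    filter_upwards [eventually_pos_dirFilter w] with p hp
    rw [quot, blockNorm_step hq hx hp.le, hx, sub_zero, mul_div_cancel_left₀ _ hp.ne',
      Function.comp_apply]
  · rw [blockNormDir, if_neg hx]
    exact tendsto_quot_of_hasFDerivAt
      ((contDiffAt_blockNorm hq hx).differentiableAt one_ne_zero).hasFDerivAt w

lemma continuous_blockNormDir (hq : 1 < q) : Continuous (blockNormDir q J x) := by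
  unfold blockNormDir
  by_cases hx : blockNorm q J x = 0
  · simpa only [if_pos hx] using continuous_blockNorm hq
  · simpa only [if_neg hx] using (fderiv ℝ (blockNorm q J) x).continuous

lemma blockNormDir_le (hq : 1 < q) : blockNormDir q J x w ≤ blockNorm q J w := by
  refine le_of_tendsto_of_tendsto (tendsto_quot_blockNorm hq x w)
    (((continuous_blockNorm hq).tendsto w).comp (tendsto_snd_dirFilter w)) ?_
  filter_upwards [eventually_pos_dirFilter w] with p hp
  rw [quot, div_le_iff₀ hp, Function.comp_apply, mul_comm, ← blockNorm_smul hq hp.le]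
  linarith [blockNorm_add_le (J := J) (x := x) (y := p.1 • p.2) hq]

/-- The semiderivative of the block norm is itself semidifferentiable. -/
lemma exists_tendsto_blockNormDir (hq : 1 < q) (x w z : EuclideanSpace ℝ (Fin n)) :
    ∃ D, Tendsto (fun p : ℝ × EuclideanSpace ℝ (Fin n) =>
      (blockNormDir q J x (w + (p.1 / 2) • p.2) - blockNormDir q J x w) / (p.1 / 2))
      (dirFilter z) (𝓝 D) := by
  by_cases hx : blockNorm q J x = 0
  · refine ⟨blockNormDir q J w z, ?_⟩
    have e : ∀ u, blockNormDir q J x u = blockNorm q J u := fun u => if_pos hx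
    simp only [e]
    have hhalf : Tendsto (fun p : ℝ × EuclideanSpace ℝ (Fin n) => (p.1 / 2, p.2))
        (dirFilter z) (dirFilter z) := by
      refine Tendsto.prodMk (tendsto_nhdsWithin_iff.2 ⟨?_, ?_⟩) (tendsto_snd_dirFilter z)
      · simpa using (tendsto_fst_dirFilter_zero z).div_const 2
      · filter_upwards [eventually_pos_dirFilter z] with p hp
        exact half_pos hp
    have h := (tendsto_quot_blockNorm (J := J) hq w z).comp hhalf
    simpa only [Function.comp_def, quot] using h
  · refine ⟨fderiv ℝ (blockNorm q J) x z, ?_⟩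
    simp only [blockNormDir, if_neg hx]
    refine (((fderiv ℝ (blockNorm q J) x).continuous.tendsto z).comp
      (tendsto_snd_dirFilter z)).congr' ?_
    filter_upwards [eventually_pos_dirFilter z] with p hp
    rw [map_add, add_sub_cancel_left, map_smul, smul_eq_mul,
      mul_div_cancel_left₀ _ (half_pos hp).ne', Function.comp_apply]

/-! ### Second-order behaviour of a block norm -/

lemma deriv_abs_rpow_zero (hq : 1 < q) : deriv (fun t : ℝ => |t| ^ q) 0 = 0 := by
  simpa using (hasDerivAt_abs_rpow 0 hq).deriv

lemma secondRem_abs_rpow_zero (hq : 1 < q) {τ d : ℝ} (hτ : 0 < τ) :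
    secondRem (fun t : ℝ => |t| ^ q) 0 0 (τ, d) = 2 * τ ^ (q - 2) * |d| ^ q := by
  simp only [secondRem, zero_add, zero_mul, sub_zero, abs_zero]
  rw [Real.zero_rpow (by positivity), abs_mul, abs_of_pos hτ, Real.mul_rpow hτ.le (abs_nonneg _),
    Real.rpow_sub hτ, Real.rpow_two]
  field_simp
  ring

/-- The second-order quotients of `|x_j|^q` as functions of the full direction. Their limit is
finite if `x_j ≠ 0` or `q ≥ 2`; otherwise they are nonnegative and of order `τ^(q - 2) |w_j|^q`,
so that they tend to `∞` when `w_j ≠ 0`, while for `w_j = 0` the value along parabolic curves is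
of order `τ^(2 q - 2)`. -/
lemma exists_epiLimAt_abs_rpow (hq : 1 < q) (x w : EuclideanSpace ℝ (Fin n)) (j : Fin n) :
    ∃ Q : EReal,
      (∀ z, EpiLimAt (fun p : ℝ × EuclideanSpace ℝ (Fin n) => secondRem (fun t : ℝ => |t| ^ q) (x j)
        (deriv (fun t : ℝ => |t| ^ q) (x j)) (p.1, p.2 j)) w (parabolicFilter w z) Q) ∧
      (x j ≠ 0 ∨ 2 ≤ q → ∃ c : ℝ, Tendsto (fun p : ℝ × EuclideanSpace ℝ (Fin n) => secondRem (fun t : ℝ => |t| ^ q) (x j)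
        (deriv (fun t : ℝ => |t| ^ q) (x j)) (p.1, p.2 j)) (dirFilter w) (𝓝 c)) := by
  have hcoord : Tendsto (fun p : ℝ × EuclideanSpace ℝ (Fin n) => p.2 j) (dirFilter w)
      (𝓝 (w j)) :=
    ((EuclideanSpace.proj (𝕜 := ℝ) j).continuous.tendsto w).comp (tendsto_snd_dirFilter w)
  have hfin : x j ≠ 0 ∨ 2 ≤ q → ∃ c : ℝ, Tendsto (fun p : ℝ × EuclideanSpace ℝ (Fin n) =>
      secondRem (fun t : ℝ => |t| ^ q) (x j)
        (deriv (fun t : ℝ => |t| ^ q) (x j)) (p.1, p.2 j)) (dirFilter w) (𝓝 c) := by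
    intro h
    by_cases hxj : x j = 0
    · have hq2 : 2 ≤ q := h.resolve_left (not_not.2 hxj)
      rw [hxj, deriv_abs_rpow_zero hq]
      refine ⟨2 * 0 ^ (q - 2) * |w j| ^ q, ?_⟩
      have h1 : Tendsto (fun p : ℝ × EuclideanSpace ℝ (Fin n) => p.1 ^ (q - 2)) (dirFilter w)
          (𝓝 (0 ^ (q - 2))) :=
        (tendsto_fst_dirFilter_zero w).rpow_const (Or.inr (by linarith))
      have h2 := hcoord.abs.rpow_const (p := q) (Or.inr (by linarith))
      refine ((h1.const_mul 2).mul h2).congr' ?_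
      filter_upwards [eventually_pos_dirFilter w] with p hp
      exact (secondRem_abs_rpow_zero hq hp).symm
    · have hC : ContDiffAt ℝ 2 (fun t : ℝ => |t| ^ q) (x j) :=
        (contDiffAt_abs hxj).rpow_const_of_ne (abs_ne_zero.2 hxj)
      have h1 : ∀ᶠ y in 𝓝 (x j), DifferentiableAt ℝ (fun t : ℝ => |t| ^ q) y :=
        Eventually.of_forall fun y => (hasDerivAt_abs_rpow y hq).differentiableAt
      have h2 : DifferentiableAt ℝ (deriv fun t : ℝ => |t| ^ q) (x j) := by
        have := (hC.fderiv_right (m := 1) (by norm_num)).differentiableAt one_ne_zero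
        exact this.clm_apply (differentiableAt_const (1 : ℝ))
      exact ⟨_, (taylor_two_peano h1 h2).tendsto (tendsto_fst_dirFilter w) hcoord
        (Eventually.of_forall fun _ => mem_univ _)⟩
  by_cases h : x j ≠ 0 ∨ 2 ≤ q
  · obtain ⟨c, hc⟩ := hfin h
    exact ⟨c, fun z => EpiLimAt.of_tendsto (parabolicFilter_le w z) hc, hfin⟩
  · have hxj : x j = 0 := by tauto
    have hq2 : q < 2 := by
      by_contra hcon
      exact h (Or.inr (not_lt.1 hcon))
    have heq : ∀ᶠ p : ℝ × EuclideanSpace ℝ (Fin n) in dirFilter w,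
        2 * p.1 ^ (q - 2) * |p.2 j| ^ q = secondRem (fun t : ℝ => |t| ^ q) (x j)
          (deriv (fun t : ℝ => |t| ^ q) (x j)) (p.1, p.2 j) := by
      filter_upwards [eventually_pos_dirFilter w] with p hp
      rw [hxj, deriv_abs_rpow_zero hq, secondRem_abs_rpow_zero hq hp]
    by_cases hwj : w j = 0
    · refine ⟨0, fun z => ?_, hfin⟩
      refine EpiLimAt.congr (EpiLimAt.of_nonneg ?_ ?_) (parabolicFilter_le w z) heq
      · filter_upwards [eventually_pos_dirFilter w] with p hp
        positivity
      · rw [parabolicFilter, tendsto_map'_iff]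
        have hcoord' : Tendsto (fun p : ℝ × EuclideanSpace ℝ (Fin n) => p.2 j) (dirFilter z)
            (𝓝 (z j)) :=
          ((EuclideanSpace.proj (𝕜 := ℝ) j).continuous.tendsto z).comp (tendsto_snd_dirFilter z)
        have h1 : Tendsto (fun p : ℝ × EuclideanSpace ℝ (Fin n) => p.1 ^ (2 * q - 2))
            (dirFilter z) (𝓝 0) := by
          have := (tendsto_fst_dirFilter_zero z).rpow_const (p := 2 * q - 2)
            (Or.inr (by linarith))
          rwa [Real.zero_rpow (by linarith)] at this
        have h2 := hcoord'.abs.rpow_const (p := q) (Or.inr (by linarith))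
        have h3 := (h1.const_mul (2 * (1 / 2 : ℝ) ^ q)).mul h2
        rw [mul_zero, zero_mul] at h3
        refine h3.congr' ?_
        filter_upwards [eventually_pos_dirFilter z] with p hp
        simp only [Function.comp_apply, PiLp.add_apply, hwj, zero_add, PiLp.smul_apply,
          smul_eq_mul]
        rw [abs_mul, abs_of_pos (half_pos hp), Real.mul_rpow (half_pos hp).le (abs_nonneg _),
          div_eq_mul_one_div p.1 2, Real.mul_rpow hp.le (by norm_num),
          show 2 * q - 2 = (q - 2) + q by ring, Real.rpow_add hp]
        ring
    · refine ⟨⊤, fun z => ?_, hfin⟩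
      refine EpiLimAt.congr (EpiLimAt.of_tendsto_atTop (parabolicFilter_le w z) ?_)
        (parabolicFilter_le w z) heq
      have h1 : Tendsto (fun p : ℝ × EuclideanSpace ℝ (Fin n) => p.1 ^ (q - 2)) (dirFilter w)
          atTop :=
        (tendsto_rpow_neg_nhdsGT_zero (by linarith)).comp (tendsto_fst_dirFilter w)
      have h2 := hcoord.abs.rpow_const (p := q) (Or.inr (by linarith))
      exact (h1.const_mul_atTop two_pos).atTop_mul_pos
        (Real.rpow_pos_of_pos (abs_pos.2 hwj) _) h2

lemma hasFDerivAt_blockPow (hq : 1 < q) (x : EuclideanSpace ℝ (Fin n)) :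
    HasFDerivAt (blockPow q J)
      (∑ j ∈ J, deriv (fun t : ℝ => |t| ^ q) (x j) • EuclideanSpace.proj (𝕜 := ℝ) j) x := by
  unfold blockPow
  refine HasFDerivAt.fun_sum fun j _ => ?_
  have h1 : HasDerivAt (fun t : ℝ => |t| ^ q) (deriv (fun t : ℝ => |t| ^ q) (x j)) (x j) :=
    (hasDerivAt_abs_rpow (x j) hq).differentiableAt.hasDerivAt
  exact h1.comp_hasFDerivAt x (EuclideanSpace.proj (𝕜 := ℝ) j).hasFDerivAt

/-- The second-order quotients of the block norm have a lower epi-limit, which is attained along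
all parabolic curves and does not depend on their second-order part. It can be infinite only if
`q < 2` and the block has both a zero and a nonzero entry. -/
lemma exists_epiLimAt_blockNorm (hq : 1 < q) (x w : EuclideanSpace ℝ (Fin n)) :
    ∃ Q : EReal,
      (∀ z, EpiLimAt (secondOrderQuot (blockNorm q J) x (blockNormDir q J x)) w
        (parabolicFilter w z) Q) ∧
      (blockNorm q J x = 0 → Q = 0) ∧
      (2 ≤ q ∨ ¬ ((∃ j ∈ J, x j = 0) ∧ ∃ j ∈ J, x j ≠ 0) →
        ∃ c : ℝ, Q = c ∧ Tendsto (secondOrderQuot (blockNorm q J) x (blockNormDir q J x))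
          (dirFilter w) (𝓝 c)) := by
  by_cases hx : blockNorm q J x = 0
  · have h0 : Tendsto (secondOrderQuot (blockNorm q J) x (blockNormDir q J x)) (dirFilter w)
        (𝓝 0) := by
      refine tendsto_const_nhds.congr' ?_
      filter_upwards [eventually_pos_dirFilter w] with p hp
      rw [secondOrderQuot, blockNorm_step hq hx hp.le, hx, blockNormDir, if_pos hx]
      simp
    exact ⟨((0 : ℝ) : EReal), fun z => EpiLimAt.of_tendsto (parabolicFilter_le w z) h0,
      fun _ => rfl, fun _ => ⟨0, rfl, h0⟩⟩
  · have hS := blockPow_pos hq hx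
    set S := blockPow q J x with hSdef
    set r : ℝ → ℝ := fun s => s ^ (1 / q) with hr
    have hC : ContDiffAt ℝ 2 r S := contDiffAt_id.rpow_const_of_ne hS.ne'
    have hr1 : ∀ᶠ y in 𝓝 S, DifferentiableAt ℝ r y :=
      (hC.eventually (by simp)).mono fun y hy => hy.differentiableAt two_ne_zero
    have hr2 : DifferentiableAt ℝ (deriv r) S :=
      ((hC.fderiv_right (m := 1) (by norm_num)).differentiableAt one_ne_zero).clm_apply
        (differentiableAt_const (1 : ℝ))
    have hr0 : 0 < deriv r S := by
      have : deriv r S = 1 / q * S ^ (1 / q - 1) :=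
        (Real.hasDerivAt_rpow_const (Or.inl hS.ne')).deriv
      rw [this]
      have := Real.rpow_pos_of_pos hS (1 / q - 1)
      positivity
    have hF := hasFDerivAt_blockPow (J := J) hq x
    have hN : HasFDerivAt (blockNorm q J) (deriv r S •
        ∑ j ∈ J, deriv (fun t : ℝ => |t| ^ q) (x j) • EuclideanSpace.proj (𝕜 := ℝ) j) x :=
      HasDerivAt.comp_hasFDerivAt (h₂ := r) x hr1.self_of_nhds.hasDerivAt hF
    have hdir : ∀ w', blockNormDir q J x w'
        = deriv r S * ∑ j ∈ J, deriv (fun t : ℝ => |t| ^ q) (x j) * w' j := by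
      intro w'
      rw [blockNormDir, if_neg hx, hN.fderiv]
      simp
    set U : Fin n → ℝ × EuclideanSpace ℝ (Fin n) → ℝ := fun j p =>
      secondRem (fun t : ℝ => |t| ^ q) (x j) (deriv (fun t : ℝ => |t| ^ q) (x j)) (p.1, p.2 j)
      with hU
    have hchain := (taylor_two_peano hr1 hr2).tendsto (tendsto_fst_dirFilter w)
      (tendsto_quot_of_hasFDerivAt hF w) (Eventually.of_forall fun _ => mem_univ _)
    set R : ℝ × EuclideanSpace ℝ (Fin n) → ℝ := fun p =>
      secondRem r S (deriv r S) (p.1, quot (blockPow q J) x p) with hR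
    have hdecomp : ∀ᶠ p in dirFilter w, R p + deriv r S * ∑ j ∈ J, U j p
        = secondOrderQuot (blockNorm q J) x (blockNormDir q J x) p := by
      filter_upwards [eventually_pos_dirFilter w] with p hp
      have e1 : S + p.1 * quot (blockPow q J) x p = blockPow q J (x + p.1 • p.2) := by
        rw [quot]; field_simp; ring
      have e2 : p.1 * quot (blockPow q J) x p = blockPow q J (x + p.1 • p.2) - S := by
        linarith
      have e3 : ∑ j ∈ J, U j p = (blockPow q J (x + p.1 • p.2) - S
          - p.1 * ∑ j ∈ J, deriv (fun t : ℝ => |t| ^ q) (x j) * p.2 j) / (p.1 ^ 2 / 2) := by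
        simp only [hU, secondRem]
        rw [← Finset.sum_div, Finset.sum_sub_distrib, Finset.sum_sub_distrib, Finset.mul_sum]
        congr 2
        refine Finset.sum_congr rfl fun j _ => by ring
      simp only [hR, secondRem]
      rw [e1, e2, e3, secondOrderQuot, hdir]
      simp only [hr, blockNorm]
      ring
    choose Q hQ hQfin using fun j => exists_epiLimAt_abs_rpow hq x w j
    refine ⟨_, fun z => ((EpiLimAt.of_tendsto (parabolicFilter_le w z) hchain).add
      ((EpiLimAt.sum J (parabolicFilter_le w z) fun j _ => hQ j z).const_mul
        (parabolicFilter_le w z) hr0.le)).congr (parabolicFilter_le w z) hdecomp,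
      fun h => absurd h hx, fun hfin => ?_⟩
    have hfin' : ∀ j ∈ J, x j ≠ 0 ∨ 2 ≤ q := by
      intro j hj
      by_contra hcon
      push Not at hcon
      refine hfin.elim (fun h => absurd h (not_le.2 hcon.2)) fun h => h ⟨⟨j, hj, hcon.1⟩, ?_⟩
      by_contra hall
      push Not at hall
      refine hx ?_
      rw [blockNorm_congr (y := 0) (by simpa using hall), blockNorm_zero hq]
    have hc : ∀ j, ∃ c : ℝ, j ∈ J → Tendsto (U j) (dirFilter w) (𝓝 c) := by
      intro j
      by_cases hj : j ∈ J
      · obtain ⟨c, hc⟩ := hQfin j (hfin' j hj)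
        exact ⟨c, fun _ => hc⟩
      · exact ⟨0, fun h => absurd h hj⟩
    choose c hc using hc
    have hlim := (hchain.add ((tendsto_finsetSum J fun j hj => hc j hj).const_mul
      (deriv r S))).congr' hdecomp
    refine ⟨_, ?_, hlim⟩
    have h1 := (((EpiLimAt.of_tendsto (parabolicFilter_le w 0) hchain).add
      ((EpiLimAt.sum J (parabolicFilter_le w 0) fun j _ => hQ j 0).const_mul
        (parabolicFilter_le w 0) hr0.le)).congr (parabolicFilter_le w 0) hdecomp).2.2
    exact tendsto_nhds_unique h1 (EpiLimAt.of_tendsto (parabolicFilter_le w 0) hlim).2.2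

end

/-! ### Separable functions and the chain rule along blocks -/

section

lemma tendsto_chain_quot {α : Type*} {l : Filter α} {g : ℝ → ℝ} {S : Set ℝ} {t a d : ℝ}
    (h : HasDerivWithinAt g a S t) {τ δ : α → ℝ} (hτ : Tendsto τ l (𝓝[>] 0))
    (hδ : Tendsto δ l (𝓝 d)) (hS : ∀ᶠ i in l, t + τ i * δ i ∈ S) :
    Tendsto (fun i => (g (t + τ i * δ i) - g t) / τ i) l (𝓝 (a * d)) := by
  have hτ0 : Tendsto τ l (𝓝 0) := hτ.mono_right nhdsWithin_le_nhds
  have h1 := h.hasFDerivWithinAt.lim (c := fun i => (τ i)⁻¹) (d := fun i => τ i * δ i) (v := d)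
    (l := l) (by simpa using hτ0.mul hδ) hS (by
      refine hδ.congr' ?_
      filter_upwards [hτ.eventually self_mem_nhdsWithin] with i hi
      have hi' : τ i ≠ 0 := ne_of_gt hi
      rw [smul_eq_mul, inv_mul_cancel_left₀ hi'])
  have h2 := h1.congr fun i => show _ = (g (t + τ i * δ i) - g t) / τ i by
    rw [smul_eq_mul, div_eq_inv_mul]
  simpa [mul_comm] using h2

variable {m n : ℕ} {q lam : ℝ} {ρ : ℝ → ℝ}

lemma separableSum_add_single (y : EuclideanSpace ℝ (Fin m)) (i : Fin m) (h : ℝ) :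
    separableSum ρ (y + EuclideanSpace.single i h) - separableSum ρ y = ρ (y i + h) - ρ (y i) := by
  rw [separableSum, separableSum, ← Finset.sum_sub_distrib, Finset.sum_eq_single i]
  · simp
  · intro k _ hk
    simp [hk]
  · simp

lemma apply_mem_regSubdiff {y u : EuclideanSpace ℝ (Fin m)}
    (hu : u ∈ regSubdiff (realToExt (separableSum ρ)) y) (i : Fin m) :
    u i ∈ regSubdiff (realToExt ρ) (y i) := by
  rw [mem_regSubdiff_realToExt] at hu ⊢
  intro ε hε
  have hpath : Tendsto (fun s : ℝ => y + EuclideanSpace.single i (s - y i)) (𝓝 (y i)) (𝓝 y) := by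
    have hc : Continuous fun s : ℝ => y + (s - y i) • EuclideanSpace.single i (1 : ℝ) := by
      fun_prop
    have h0 := hc.tendsto (y i)
    rw [sub_self, zero_smul, add_zero] at h0
    refine h0.congr fun s => ?_
    congr 1
    ext k
    by_cases hk : k = i <;> simp [hk]
  filter_upwards [hpath.eventually (hu ε hε)] with s hs
  rw [separableSum_add_single, add_sub_cancel_left, PiLp.norm_single,
    EuclideanSpace.inner_single_right, add_sub_cancel] at hs
  simpa [mul_comm] using hs

lemma mem_regSubdiff_separableSum {y u : EuclideanSpace ℝ (Fin m)}
    (hu : ∀ i, u i ∈ regSubdiff (realToExt ρ) (y i)) :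
    u ∈ regSubdiff (realToExt (separableSum ρ)) y := by
  rw [mem_regSubdiff_realToExt]
  intro ε hε
  have hε' : 0 < ε / (m + 1) := by positivity
  have h1 : ∀ᶠ y' in 𝓝 y, ∀ i, -(ε / (m + 1) * ‖y' i - y i‖)
      ≤ ρ (y' i) - ρ (y i) - inner ℝ (u i) (y' i - y i) := by
    refine eventually_all.2 fun i => ?_
    exact ((EuclideanSpace.proj (𝕜 := ℝ) i).continuous.tendsto y).eventually
      (mem_regSubdiff_realToExt.1 (hu i) _ hε')
  filter_upwards [h1] with y' hy'
  have e : separableSum ρ y' - separableSum ρ y - inner ℝ u (y' - y)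
      = ∑ i, (ρ (y' i) - ρ (y i) - inner ℝ (u i) (y' i - y i)) := by
    simp [separableSum, PiLp.inner_apply, Finset.sum_sub_distrib]
  rw [e]
  have h2 : ∀ i, -(ε / (m + 1) * ‖y' - y‖)
      ≤ ρ (y' i) - ρ (y i) - inner ℝ (u i) (y' i - y i) := by
    intro i
    refine le_trans (neg_le_neg (mul_le_mul_of_nonneg_left ?_ hε'.le)) (hy' i)
    exact PiLp.norm_apply_le (y' - y) i
  calc -(ε * ‖y' - y‖) ≤ ∑ _i : Fin m, -(ε / (m + 1) * ‖y' - y‖) := by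
        rw [Finset.sum_const, Finset.card_univ, Fintype.card_fin, nsmul_eq_mul]
        have : (m : ℝ) * (ε / (m + 1)) ≤ ε := by
          rw [← mul_div_assoc, div_le_iff₀ (by positivity)]
          nlinarith
        nlinarith [mul_le_mul_of_nonneg_right this (norm_nonneg (y' - y))]
    _ ≤ _ := Finset.sum_le_sum fun i _ => h2 i

/-- At a positive coordinate, a limiting subgradient of the separable sum of a penalty is the
derivative of the penalty. -/
lemma IsPenalty.apply_eq_slope (h : IsPenalty lam ρ) {y u : EuclideanSpace ℝ (Fin m)}
    (hu : u ∈ subdiff (realToExt (separableSum ρ)) y) {i : Fin m} (hi : y i ≠ 0) :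
    u i = penaltySlope lam ρ (y i) := by
  obtain ⟨-, -, z, w, hz, -, hw, hwu⟩ := hu
  have hzi : Tendsto (fun k => z k i) atTop (𝓝 (y i)) :=
    ((EuclideanSpace.proj (𝕜 := ℝ) i).continuous.tendsto y).comp hz
  have hwi : Tendsto (fun k => w k i) atTop (𝓝 (u i)) :=
    ((EuclideanSpace.proj (𝕜 := ℝ) i).continuous.tendsto u).comp hwu
  rw [penaltySlope_of_ne hi]
  refine tendsto_nhds_unique hwi
    (((h.continuousAt_deriv_and_expansion hi).1.tendsto.comp hzi).congr' ?_)
  filter_upwards [hzi.eventually (isOpen_ne.mem_nhds hi)] with k hk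
  exact ((mem_regSubdiff_iff_of_hasDerivAt (h.differentiableAt _ hk).hasDerivAt).1
    (apply_mem_regSubdiff (hw k) i)).symm

lemma IsPenalty.slope_mem_regSubdiff (h : IsPenalty lam ρ) (hlam : 0 < lam) (t : ℝ) :
    penaltySlope lam ρ t ∈ regSubdiff (realToExt ρ) t := by
  rcases eq_or_ne t 0 with rfl | ht
  · obtain ⟨ha, ⟨b, hb, hb'⟩, -⟩ := h.exists_slopes_zero hlam
    rw [penaltySlope_zero]
    exact mem_regSubdiff_of_hasDerivWithinAt ha hb' hb le_rfl
  · rw [penaltySlope_of_ne ht, mem_regSubdiff_iff_of_hasDerivAt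
      (h.differentiableAt _ ht).hasDerivAt]

/-- Directional derivative of a penalty. At the origin only nonnegative limit directions are
considered, although they may be approached by negative ones. -/
lemma IsPenalty.tendsto_quot (h : IsPenalty lam ρ) (hlam : 0 < lam) {t d : ℝ}
    (htd : t = 0 → 0 ≤ d) {α : Type*} {l : Filter α} {τ δ : α → ℝ} (hτ : Tendsto τ l (𝓝[>] 0))
    (hδ : Tendsto δ l (𝓝 d)) :
    Tendsto (fun i => (ρ (t + τ i * δ i) - ρ t) / τ i) l (𝓝 (penaltySlope lam ρ t * d)) := by
  have hpos : ∀ᶠ i in l, 0 < τ i := hτ.eventually self_mem_nhdsWithin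
  rcases eq_or_ne t 0 with rfl | ht
  · obtain ⟨ha, ⟨b, -, hb⟩, -⟩ := h.exists_slopes_zero hlam
    rw [penaltySlope_zero]
    rcases (htd rfl).eq_or_lt with rfl | hd
    · -- The two one-sided slopes differ, but they are multiplied by `d = 0`.
      have hl : l = (l ⊓ 𝓟 {i | 0 ≤ τ i * δ i}) ⊔ (l ⊓ 𝓟 {i | τ i * δ i ≤ 0}) := by
        rw [← inf_sup_left, sup_principal,
          show {i | 0 ≤ τ i * δ i} ∪ {i | τ i * δ i ≤ 0} = univ from
            eq_univ_of_forall fun i => le_total 0 (τ i * δ i), principal_univ, inf_top_eq]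
      rw [hl, tendsto_sup]
      constructor
      · refine tendsto_chain_quot ha (hτ.mono_left inf_le_left) (hδ.mono_left inf_le_left) ?_
        filter_upwards [mem_inf_of_right (mem_principal_self _)] with i hi
        rw [zero_add]; exact hi
      · have := tendsto_chain_quot hb (hτ.mono_left inf_le_left)
          (hδ.mono_left (inf_le_left (b := 𝓟 {i | τ i * δ i ≤ 0}))) (by
            filter_upwards [mem_inf_of_right (mem_principal_self _)] with i hi
            rw [zero_add]; exact hi)
        rwa [mul_zero] at this ⊢
    · refine tendsto_chain_quot ha hτ hδ ?_
      filter_upwards [hpos, hδ.eventually (lt_mem_nhds hd)] with i h1 h2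
      rw [zero_add]; exact (mul_pos h1 h2).le
  · rw [penaltySlope_of_ne ht]
    exact tendsto_chain_quot (h.differentiableAt t ht).hasDerivAt.hasDerivWithinAt hτ hδ
      (Eventually.of_forall fun _ => mem_univ _)

/-! ### The composition of a penalty with one block norm -/

variable {J : Finset (Fin n)} {x v : EuclideanSpace ℝ (Fin n)}

/-- The inner product of the blocks `v_J` and `w_J`. -/
noncomputable def blockInner (J : Finset (Fin n)) (v w : EuclideanSpace ℝ (Fin n)) : ℝ :=
  ∑ j ∈ J, v j * w j

/-- The vector `w` with the entries outside the block `J` replaced by zero. -/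
noncomputable def blockRestrict (J : Finset (Fin n)) (w : EuclideanSpace ℝ (Fin n)) :
    EuclideanSpace ℝ (Fin n) :=
  WithLp.toLp 2 fun j => if j ∈ J then w j else 0

lemma continuous_blockInner (v : EuclideanSpace ℝ (Fin n)) : Continuous (blockInner J v) := by
  unfold blockInner
  fun_prop

lemma blockInner_add_smul (v w z : EuclideanSpace ℝ (Fin n)) (c : ℝ) :
    blockInner J v (w + c • z) = blockInner J v w + c * blockInner J v z := by
  simp only [blockInner, PiLp.add_apply, PiLp.smul_apply, smul_eq_mul, Finset.mul_sum,
    ← Finset.sum_add_distrib]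
  exact Finset.sum_congr rfl fun j _ => by ring

lemma inner_blockRestrict (v w : EuclideanSpace ℝ (Fin n)) :
    inner ℝ v (blockRestrict J w) = blockInner J v w := by
  simp [blockRestrict, blockInner, PiLp.inner_apply, mul_comm]

lemma quot_step {g : EuclideanSpace ℝ (Fin n) → ℝ} {p : ℝ × EuclideanSpace ℝ (Fin n)}
    (hp : 0 < p.1) : g x + p.1 * quot g x p = g (x + p.1 • p.2) := by
  rw [quot, mul_div_cancel₀ _ hp.ne']
  ring

lemma IsPenalty.tendsto_quot_block (h : IsPenalty lam ρ) (hlam : 0 < lam) (hq : 1 < q)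
    (x w : EuclideanSpace ℝ (Fin n)) :
    Tendsto (quot (fun y => ρ (blockNorm q J y)) x) (dirFilter w)
      (𝓝 (penaltySlope lam ρ (blockNorm q J x) * blockNormDir q J x w)) := by
  refine (tendsto_chain_quot (h.hasDerivWithinAt_Ici_zero hlam blockNorm_nonneg)
    (tendsto_fst_dirFilter w) (tendsto_quot_blockNorm hq x w) ?_).congr' ?_
  · filter_upwards [eventually_pos_dirFilter w] with p hp
    rw [quot_step hp]
    exact blockNorm_nonneg
  · filter_upwards [eventually_pos_dirFilter w] with p hp
    rw [quot_step hp, quot]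

/-- Upper semicontinuity in the base point of the directional derivative of a penalty composed
with a block norm. It is here that `lam > 0` matters, and that the slope of the penalty is
continuous on `[0, ∞)`. -/
lemma IsPenalty.eventually_slope_mul_le (h : IsPenalty lam ρ) (hlam : 0 < lam) (hq : 1 < q)
    (x w : EuclideanSpace ℝ (Fin n)) {ε : ℝ} (hε : 0 < ε) :
    ∀ᶠ y in 𝓝 x, penaltySlope lam ρ (blockNorm q J y) * blockNormDir q J y w
      ≤ penaltySlope lam ρ (blockNorm q J x) * blockNormDir q J x w + ε := by
  have hσ : Tendsto (fun y => penaltySlope lam ρ (blockNorm q J y)) (𝓝 x)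
      (𝓝 (penaltySlope lam ρ (blockNorm q J x))) := by
    refine ((h.continuousOn_slope hlam) _ blockNorm_nonneg).tendsto.comp ?_
    exact tendsto_nhdsWithin_iff.2 ⟨(continuous_blockNorm hq).tendsto x,
      Eventually.of_forall fun _ => blockNorm_nonneg⟩
  by_cases hx : blockNorm q J x = 0
  · have h1 : Tendsto (fun y => penaltySlope lam ρ (blockNorm q J y) * blockNorm q J w) (𝓝 x)
        (𝓝 (penaltySlope lam ρ (blockNorm q J x) * blockNormDir q J x w)) := by
      rw [blockNormDir, if_pos hx]
      exact hσ.mul_const _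
    have h2 : ∀ᶠ y in 𝓝 x, 0 < penaltySlope lam ρ (blockNorm q J y) := by
      refine hσ.eventually (lt_mem_nhds ?_)
      rwa [hx, penaltySlope_zero]
    filter_upwards [h2, h1.eventually (gt_mem_nhds (lt_add_of_pos_right _ hε))] with y hy1 hy2
    exact (mul_le_mul_of_nonneg_left (blockNormDir_le hq) hy1.le).trans hy2.le
  · have hd : Tendsto (fun y => blockNormDir q J y w) (𝓝 x) (𝓝 (blockNormDir q J x w)) := by
      have hf : ContinuousAt (fun y => fderiv ℝ (blockNorm q J) y w) x :=
        ((contDiffAt_blockNorm hq hx).fderiv_right (m := 0) (by norm_num)).continuousAt.clm_apply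
          continuousAt_const
      have hne : ∀ᶠ y in 𝓝 x, blockNorm q J y ≠ 0 :=
        (continuous_blockNorm hq).continuousAt.eventually_ne hx
      have : Tendsto (fun y => fderiv ℝ (blockNorm q J) y w) (𝓝 x)
          (𝓝 (blockNormDir q J x w)) := by
        rw [blockNormDir, if_neg hx]; exact hf
      refine this.congr' ?_
      filter_upwards [hne] with y hy
      rw [blockNormDir, if_neg hy]
    filter_upwards [(hσ.mul hd).eventually (gt_mem_nhds (lt_add_of_pos_right _ hε))] with y hy
    exact hy.le

lemma IsPenalty.slope_nonneg (h : IsPenalty lam ρ) (hlam : 0 < lam)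
    (hmono : MonotoneOn ρ (Ici 0)) {t : ℝ} (ht : 0 ≤ t) : 0 ≤ penaltySlope lam ρ t := by
  rw [← (h.hasDerivWithinAt_Ici_zero hlam ht).derivWithin (uniqueDiffOn_Ici 0 t ht)]
  exact hmono.derivWithin_nonneg

lemma EpiLimAt.const_mul_of_nonneg_or_tendsto {w : EuclideanSpace ℝ (Fin n)}
    {T : ℝ × EuclideanSpace ℝ (Fin n) → ℝ} {l : Filter (ℝ × EuclideanSpace ℝ (Fin n))} {Q : EReal} {a : ℝ}
    (hT : EpiLimAt T w l Q) (hl : l ≤ dirFilter w)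
    (ha : 0 ≤ a ∨ ∃ c : ℝ, Q = c ∧ Tendsto T (dirFilter w) (𝓝 c)) :
    EpiLimAt (fun p => a * T p) w l (a * Q) := by
  rcases ha with ha | ⟨c, rfl, hc⟩
  · exact hT.const_mul hl ha
  · rw [← EReal.coe_mul]
    exact EpiLimAt.of_tendsto hl (hc.const_mul a)

/-- The contribution of one block to the second-order quotients of the composite function
converges along every fixed direction to its lower epi-limit. It is the sum of the second-order
remainder of the penalty, of the second-order quotients of the block norm scaled by the slope, and
of `2 (a dN(w') - ⟨v, w'⟩) / τ`, which is nonnegative and produces the indicator function of the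
critical directions. -/
lemma IsPenalty.exists_epiLimAt_block (h : IsPenalty lam ρ) (hlam : 0 < lam) (hq : 1 < q)
    (hv : ∀ w, blockInner J v w
      ≤ penaltySlope lam ρ (blockNorm q J x) * blockNormDir q J x w)
    (ha : 0 ≤ penaltySlope lam ρ (blockNorm q J x) ∨
      (2 ≤ q ∨ ¬ ((∃ j ∈ J, x j = 0) ∧ ∃ j ∈ J, x j ≠ 0)))
    (w : EuclideanSpace ℝ (Fin n)) :
    ∃ L, EpiLimAt (secondOrderQuot (fun y => ρ (blockNorm q J y)) x (blockInner J v)) w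
      (rayFilter w) L := by
  set a := penaltySlope lam ρ (blockNorm q J x) with ha_def
  obtain ⟨cp, cm, hexp⟩ := h.exists_expansion hlam (t := blockNorm q J x) blockNorm_nonneg
  have hR := hexp.tendsto (tendsto_fst_dirFilter w) (tendsto_quot_blockNorm hq x w) (by
    filter_upwards [eventually_pos_dirFilter w] with p hp
    show 0 ≤ _
    rw [quot_step hp]
    exact blockNorm_nonneg)
  obtain ⟨Q, hQ, -, hQfin⟩ := exists_epiLimAt_blockNorm (J := J) hq x w
  have hT := ((hQ 0).mono (rayFilter_le_parabolicFilter w)).const_mul_of_nonneg_or_tendsto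
    (a := a) (rayFilter_le w) (ha.imp_right hQfin)
  set V : ℝ × EuclideanSpace ℝ (Fin n) → ℝ := fun p =>
    2 * (a * blockNormDir q J x p.2 - blockInner J v p.2) * p.1⁻¹ with hV_def
  have hV : ∃ M, EpiLimAt V w (rayFilter w) M := by
    rcases (hv w).eq_or_lt with heq | hlt
    · refine ⟨0, EpiLimAt.of_nonneg ?_ ?_⟩
      · filter_upwards [eventually_pos_dirFilter w] with p hp
        have := sub_nonneg.2 (hv p.2)
        positivity
      · rw [rayFilter, tendsto_map'_iff]
        refine tendsto_const_nhds.congr fun τ => ?_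
        simp [hV_def, heq]
    · refine ⟨⊤, EpiLimAt.of_tendsto_atTop (rayFilter_le w) ?_⟩
      have h1 : Tendsto (fun p : ℝ × EuclideanSpace ℝ (Fin n) =>
          2 * (a * blockNormDir q J x p.2 - blockInner J v p.2)) (dirFilter w)
          (𝓝 (2 * (a * blockNormDir q J x w - blockInner J v w))) := by
        have hc : Continuous fun u => 2 * (a * blockNormDir q J x u - blockInner J v u) :=
          ((continuous_const.mul (continuous_blockNormDir hq)).sub
            (continuous_blockInner v)).const_mul 2
        exact (hc.tendsto w).comp (tendsto_snd_dirFilter w)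
      have h2 : Tendsto (fun p : ℝ × EuclideanSpace ℝ (Fin n) => p.1⁻¹) (dirFilter w) atTop :=
        tendsto_inv_nhdsGT_zero.comp (tendsto_fst_dirFilter w)
      exact h1.pos_mul_atTop (by linarith) h2
  obtain ⟨M, hM⟩ := hV
  refine ⟨_, (((EpiLimAt.of_tendsto (rayFilter_le w) hR).add hT).add hM).congr
    (rayFilter_le w) ?_⟩
  filter_upwards [eventually_pos_dirFilter w] with p hp
  have e1 := quot_step (g := blockNorm q J) (x := x) hp
  have e2 : p.1 * quot (blockNorm q J) x p
      = blockNorm q J (x + p.1 • p.2) - blockNorm q J x := by linarith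
  simp only [secondRem, secondOrderQuot, hV_def]
  rw [e1, e2]
  field_simp
  ring

end

/-! ### The group sparsity function -/

section

variable {m n : ℕ} {q lam : ℝ} {ρ : ℝ → ℝ} {J : Fin m → Finset (Fin n)}
  {x v : EuclideanSpace ℝ (Fin n)}

lemma inner_eq_sum_blockInner (hJ : IsBlockPartition J) (v w : EuclideanSpace ℝ (Fin n)) :
    inner ℝ v w = ∑ i, blockInner (J i) v w := by
  have huniv : (Finset.univ : Finset (Fin n)) = Finset.univ.biUnion J := by
    ext j
    simpa using hJ.2.2 j
  simp only [blockInner]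
  rw [PiLp.inner_apply, huniv, Finset.sum_biUnion fun i _ k _ hik => hJ.2.1 hik]
  simp [mul_comm]

lemma tendsto_quot_blockNorms (hq : 1 < q) (x w : EuclideanSpace ℝ (Fin n)) (i : Fin m) :
    Tendsto (quot (fun y => blockNorms q J y i) x) (dirFilter w)
      (𝓝 (blockNormDir q (J i) x w)) :=
  tendsto_quot_blockNorm hq x w

lemma mapSemideriv_blockNorms (hq : 1 < q) (x w : EuclideanSpace ℝ (Fin n)) :
    mapSemideriv (blockNorms q J) x w = WithLp.toLp 2 fun i => blockNormDir q (J i) x w := by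
  unfold mapSemideriv
  congr 1
  funext i
  exact semideriv_eq (tendsto_quot_blockNorms hq x w i)

/-- The composite function `x ↦ ∑ ρ(‖x_{J_i}‖_q)`. -/
noncomputable def groupPenalty (q : ℝ) (ρ : ℝ → ℝ) (J : Fin m → Finset (Fin n))
    (y : EuclideanSpace ℝ (Fin n)) : ℝ := separableSum ρ (blockNorms q J y)

/-- The slopes of the penalty at the block norms. They form the multiplier for which the
second-order condition holds. -/
noncomputable def slopeVector (lam q : ℝ) (ρ : ℝ → ℝ) (J : Fin m → Finset (Fin n))
    (x : EuclideanSpace ℝ (Fin n)) : EuclideanSpace ℝ (Fin m) :=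
  WithLp.toLp 2 fun i => penaltySlope lam ρ (blockNorm q (J i) x)

lemma tendsto_quot_groupPenalty (h : IsPenalty lam ρ) (hlam : 0 < lam) (hq : 1 < q)
    (x w : EuclideanSpace ℝ (Fin n)) :
    Tendsto (quot (groupPenalty q ρ J) x) (dirFilter w)
      (𝓝 (∑ i, penaltySlope lam ρ (blockNorm q (J i) x) * blockNormDir q (J i) x w)) := by
  refine (tendsto_finsetSum Finset.univ fun i _ =>
    h.tendsto_quot_block (J := J i) hlam hq x w).congr fun p => ?_
  simp only [quot]
  rw [← Finset.sum_div, Finset.sum_sub_distrib]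
  rfl

/-- Every limiting subgradient of the group sparsity function is dominated, block by block, by
the directional derivatives of that function. -/
lemma IsPenalty.blockInner_le (h : IsPenalty lam ρ) (hlam : 0 < lam) (hq : 1 < q)
    (hJ : IsBlockPartition J) (hv : v ∈ subdiff (realToExt (groupPenalty q ρ J)) x)
    (i : Fin m) (w : EuclideanSpace ℝ (Fin n)) :
    blockInner (J i) v w
      ≤ penaltySlope lam ρ (blockNorm q (J i) x) * blockNormDir q (J i) x w := by
  obtain ⟨-, -, y, u, hy, -, hu, huv⟩ := hv
  have hstep : ∀ k, blockInner (J i) (u k) w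
      ≤ penaltySlope lam ρ (blockNorm q (J i) (y k)) * blockNormDir q (J i) (y k) w := by
    intro k
    rw [← inner_blockRestrict]
    refine inner_le_of_mem_regSubdiff (hu k) ?_
    have h1 : Tendsto (fun τ : ℝ => quot (fun z => ρ (blockNorm q (J i) z)) (y k) (τ, w))
        (𝓝[>] 0) (𝓝 (penaltySlope lam ρ (blockNorm q (J i) (y k))
          * blockNormDir q (J i) (y k) w)) := by
      have := (h.tendsto_quot_block (J := J i) hlam hq (y k) w).mono_left (rayFilter_le w)
      rwa [rayFilter, tendsto_map'_iff] at this
    refine h1.congr fun τ => ?_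
    have hself : blockNorm q (J i) (y k + τ • blockRestrict (J i) w)
        = blockNorm q (J i) (y k + τ • w) :=
      blockNorm_congr fun j hj => by simp [blockRestrict, hj]
    have hother : ∀ l, l ≠ i → blockNorm q (J l) (y k + τ • blockRestrict (J i) w)
        = blockNorm q (J l) (y k) := fun l hl =>
      blockNorm_congr fun j hj => by
        have : j ∉ J i := Finset.disjoint_left.1 (hJ.2.1 hl) hj
        simp [blockRestrict, this]
    rw [quot]
    congr 1
    show _ = ∑ l, ρ (blockNorm q (J l) (y k + τ • blockRestrict (J i) w))
      - ∑ l, ρ (blockNorm q (J l) (y k))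
    rw [← Finset.sum_sub_distrib, Finset.sum_eq_single i]
    · rw [hself]
    · intro l _ hl
      rw [hother l hl, sub_self]
    · simp
  have hlim : Tendsto (fun k => blockInner (J i) (u k) w) atTop (𝓝 (blockInner (J i) v w)) := by
    have hc : Continuous fun u : EuclideanSpace ℝ (Fin n) => blockInner (J i) u w := by
      unfold blockInner
      fun_prop
    exact (hc.tendsto v).comp huv
  refine le_of_forall_pos_le_add fun ε hε => le_of_tendsto hlim ?_
  filter_upwards [hy.eventually (h.eventually_slope_mul_le (J := J i) hlam hq x w hε)] with k hk
  exact (hstep k).trans hk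

lemma IsPenalty.slope_nonneg_or (h : IsPenalty lam ρ) (hlam : 0 < lam)
    (hmono : q < 2 → HasMixedBlock J x → MonotoneOn ρ (Ici 0)) (i : Fin m) :
    0 ≤ penaltySlope lam ρ (blockNorm q (J i) x) ∨
      (2 ≤ q ∨ ¬ ((∃ j ∈ J i, x j = 0) ∧ ∃ j ∈ J i, x j ≠ 0)) := by
  by_contra hcon
  push Not at hcon
  obtain ⟨h1, h2, h3⟩ := hcon
  exact absurd (h.slope_nonneg hlam (hmono h2 ⟨i, h3⟩) blockNorm_nonneg) (not_le.2 h1)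

lemma IsPenalty.exists_epiLimAt_groupPenalty (h : IsPenalty lam ρ) (hlam : 0 < lam) (hq : 1 < q)
    (hJ : IsBlockPartition J) (hv : v ∈ subdiff (realToExt (groupPenalty q ρ J)) x)
    (hmono : q < 2 → HasMixedBlock J x → MonotoneOn ρ (Ici 0)) (w : EuclideanSpace ℝ (Fin n)) :
    ∃ L, EpiLimAt (secondOrderQuot (groupPenalty q ρ J) x fun w' => inner ℝ v w') w
      (rayFilter w) L := by
  choose L hL using fun i => h.exists_epiLimAt_block hlam hq
    (h.blockInner_le hlam hq hJ hv i) (h.slope_nonneg_or hlam hmono i) w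
  refine ⟨_, (EpiLimAt.sum Finset.univ (rayFilter_le w) fun i _ => hL i).congr (rayFilter_le w)
    (Eventually.of_forall fun p => ?_)⟩
  simp only [secondOrderQuot]
  rw [← Finset.sum_div, Finset.sum_sub_distrib, Finset.sum_sub_distrib, ← Finset.mul_sum,
    ← inner_eq_sum_blockInner hJ]
  rfl

/-- The parabolic quotients of a block norm are its second-order quotients along parabolic curves
plus difference quotients of its semiderivative. -/
lemma hasParabolicSemideriv_blockNorm (hq : 1 < q) {J : Finset (Fin n)}
    {w z : EuclideanSpace ℝ (Fin n)} {Q : EReal} {D : ℝ}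
    (hQ : EpiLimAt (secondOrderQuot (blockNorm q J) x (blockNormDir q J x)) w
      (parabolicFilter w z) Q)
    (hD : Tendsto (fun p : ℝ × EuclideanSpace ℝ (Fin n) =>
      (blockNormDir q J x (w + (p.1 / 2) • p.2) - blockNormDir q J x w) / (p.1 / 2))
      (dirFilter z) (𝓝 D)) :
    HasParabolicSemideriv (blockNorm q J) x w z (Q + D) := by
  have h1 := hQ.2.2
  rw [parabolicFilter, tendsto_map'_iff] at h1
  have h2 : Tendsto _ (dirFilter z) (𝓝 (D : EReal)) :=
    (continuous_coe_real_ereal.tendsto D).comp hD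
  have h3 := (EReal.continuousAt_add (p := (Q, (D : EReal))) (Or.inr (EReal.coe_ne_bot D))
    (Or.inl hQ.1)).tendsto.comp (h1.prodMk_nhds h2)
  refine h3.congr' ?_
  filter_upwards [eventually_pos_dirFilter z] with p hp
  rw [parabolicQuot, semideriv_eq (tendsto_quot_blockNorm hq x w),
    secondOrderQuot_parabolic (D := blockNormDir q J x) p hp, EReal.coe_add]
  rfl

lemma coe_mul_add_coe {Q : EReal} {a : ℝ} (D : ℝ) (ha : 0 ≤ a ∨ ∃ c : ℝ, Q = c) :
    (a : EReal) * (Q + D) = a * Q + ((a * D : ℝ) : EReal) := by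
  rcases ha with ha | ⟨c, rfl⟩
  · rw [EReal.left_distrib_of_nonneg_of_ne_top (by exact_mod_cast ha) (EReal.coe_ne_top a),
      EReal.coe_mul]
  · rw [← EReal.coe_add, ← EReal.coe_mul, ← EReal.coe_mul, ← EReal.coe_add, mul_add]

lemma coe_sum_ereal {ι : Type*} (s : Finset ι) (c : ι → ℝ) :
    ((∑ i ∈ s, c i : ℝ) : EReal) = ∑ i ∈ s, (c i : EReal) := by
  classical
  induction s using Finset.induction_on with
  | empty => simp
  | insert i s hi ih => rw [Finset.sum_insert hi, Finset.sum_insert hi, EReal.coe_add, ih]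

/-- The second-order condition, with the slopes of the penalty as multiplier. For every `z` the
supremum over the active subgradients is at least its value at the multiplier, which exceeds the
second subderivative by a sum of terms `a D(z) - ⟨v, z⟩`, nonnegative because the criticality of
`w` makes `a dN(w) - ⟨v, w⟩` minimal in every block. For `z = 0` all subgradients give the same
value: they agree on the blocks with `x_J ≠ 0`, and the other blocks contribute nothing. -/
lemma IsPenalty.sufficientCondition (h : IsPenalty lam ρ) (hlam : 0 < lam) (hq : 1 < q)
    (hJ : IsBlockPartition J) (hv : v ∈ subdiff (realToExt (groupPenalty q ρ J)) x)
    (hmono : q < 2 → HasMixedBlock J x → MonotoneOn ρ (Ici 0)) :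
    SufficientCondition (realToExt (separableSum ρ)) (blockNorms q J) x v := by
  have hblock := h.blockInner_le hlam hq hJ hv
  set a : Fin m → ℝ := fun i => penaltySlope lam ρ (blockNorm q (J i) x) with ha_def
  set ξ := slopeVector lam q ρ J x with hξ_def
  have hξ : ξ ∈ subdiff (realToExt (separableSum ρ)) (blockNorms q J x) :=
    regSubdiff_subset_subdiff (mem_regSubdiff_separableSum fun i =>
      h.slope_mem_regSubdiff hlam _)
  have hinner : ∀ w, inner ℝ ξ (mapSemideriv (blockNorms q J) x w)
      = ∑ i, a i * blockNormDir q (J i) x w := by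
    intro w
    rw [mapSemideriv_blockNorms hq, PiLp.inner_apply]
    simp [hξ_def, slopeVector, ha_def, mul_comm]
  refine ⟨ξ, ⟨hξ, fun w => ?_⟩, fun w hw => ?_⟩
  · rw [hinner, inner_eq_sum_blockInner hJ]
    exact Finset.sum_le_sum fun i _ => hblock i w
  have hcrit : ∀ i, blockInner (J i) v w = a i * blockNormDir q (J i) x w := by
    have hw' : subderiv (realToExt (groupPenalty q ρ J)) x w = ((inner ℝ v w : ℝ) : EReal) := hw
    rw [subderiv_realToExt (tendsto_quot_groupPenalty h hlam hq x w), EReal.coe_eq_coe_iff,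
      inner_eq_sum_blockInner hJ] at hw'
    have := (Finset.sum_eq_sum_iff_of_le fun i _ => hblock i w).1 hw'.symm
    exact fun i => this i (Finset.mem_univ i)
  choose Q hQ hQ0 hQfin using fun i => exists_epiLimAt_blockNorm (J := J i) hq x w
  have hor : ∀ i, 0 ≤ a i ∨ ∃ c : ℝ, Q i = c ∧ Tendsto
      (secondOrderQuot (blockNorm q (J i)) x (blockNormDir q (J i) x)) (dirFilter w) (𝓝 c) :=
    fun i => (h.slope_nonneg_or hlam hmono i).imp_right (hQfin i)
  have hor' : ∀ i, 0 ≤ a i ∨ ∃ c : ℝ, Q i = c :=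
    fun i => (hor i).imp_right fun ⟨c, hc, _⟩ => ⟨c, hc⟩
  have hR : secondSubderiv (realToExt fun y => inner ℝ ξ (blockNorms q J y)) x w
      = ∑ i, (a i : EReal) * Q i := by
    have hfun : (fun y => inner ℝ ξ (blockNorms q J y))
        = fun y => ∑ i, a i * blockNorm q (J i) y := by
      funext y
      rw [PiLp.inner_apply]
      simp [hξ_def, slopeVector, ha_def, mul_comm, blockNorms, blockNorm, blockPow]
    have hquot : ∀ w', Tendsto (quot (fun y => ∑ i, a i * blockNorm q (J i) y) x) (dirFilter w')
        (𝓝 (∑ i, a i * blockNormDir q (J i) x w')) := by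
      intro w'
      refine (tendsto_finsetSum Finset.univ fun i _ =>
        (tendsto_quot_blockNorm (J := J i) hq x w').const_mul (a i)).congr fun p => ?_
      simp only [quot]
      rw [← Finset.sum_sub_distrib, Finset.sum_div]
      exact Finset.sum_congr rfl fun i _ => by ring
    have hepi := EpiLimAt.sum Finset.univ (rayFilter_le w) fun i _ =>
      ((hQ i 0).mono (rayFilter_le_parabolicFilter w)).const_mul_of_nonneg_or_tendsto
        (rayFilter_le w) (hor i)
    rw [hfun, secondSubderiv_realToExt hquot w, ← hepi.liminf_eq (rayFilter_le w)]
    congr 1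
    funext p
    congr 1
    simp only [secondOrderQuot]
    rw [← Finset.sum_sub_distrib, Finset.mul_sum, ← Finset.sum_sub_distrib, Finset.sum_div]
    exact Finset.sum_congr rfl fun i _ => by ring
  have hψ : ∀ (z : EuclideanSpace ℝ (Fin n)) (i : Fin m) (D : ℝ),
      Tendsto (fun p : ℝ × EuclideanSpace ℝ (Fin n) =>
        (blockNormDir q (J i) x (w + (p.1 / 2) • p.2) - blockNormDir q (J i) x w) / (p.1 / 2))
        (dirFilter z) (𝓝 D) →
      parabolicSemideriv (fun y => blockNorms q J y i) x w z = Q i + D := fun z i D hD =>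
    Tendsto.limUnder_eq (hasParabolicSemideriv_blockNorm hq (hQ i z) hD)
  rw [hR]
  apply le_antisymm
  · -- The value at `z = 0`; the difference quotients of the semiderivatives vanish there.
    refine (iInf_le _ 0).trans ?_
    rw [inner_zero_right, EReal.coe_zero, sub_zero]
    refine iSup₂_le fun u hu => le_of_eq ?_
    refine Finset.sum_congr rfl fun i _ => ?_
    have hD0 : Tendsto (fun p : ℝ × EuclideanSpace ℝ (Fin n) =>
        (blockNormDir q (J i) x (w + (p.1 / 2) • p.2) - blockNormDir q (J i) x w) / (p.1 / 2))
        (dirFilter 0) (𝓝 0) := by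
      obtain ⟨D, hD⟩ := exists_tendsto_blockNormDir (J := J i) hq x w 0
      have h1 := hD.mono_left (rayFilter_le 0)
      rw [rayFilter, tendsto_map'_iff] at h1
      have : D = 0 := tendsto_nhds_unique h1 (tendsto_const_nhds.congr fun τ => by simp)
      rwa [this] at hD
    rw [hψ 0 i 0 hD0, EReal.coe_zero, add_zero]
    by_cases hx : blockNorm q (J i) x = 0
    · rw [hQ0 i hx, mul_zero, mul_zero]
    · rw [h.apply_eq_slope hu.1 (i := i) hx]
      rfl
  · refine le_iInf fun z => ?_
    rw [EReal.le_sub_iff_add_le (Or.inl (EReal.coe_ne_bot _)) (Or.inl (EReal.coe_ne_top _))]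
    choose D hD using fun i => exists_tendsto_blockNormDir (J := J i) hq x w z
    have hact : ξ ∈ activeSubgradients (realToExt (separableSum ρ)) (blockNorms q J x)
        (mapSemideriv (blockNorms q J) x w) := by
      refine ⟨hξ, ?_⟩
      rw [hinner]
      refine subderiv_realToExt ?_
      rw [mapSemideriv_blockNorms hq]
      refine (tendsto_finsetSum Finset.univ fun i _ =>
        h.tendsto_quot (t := blockNorm q (J i) x) (d := blockNormDir q (J i) x w) hlam ?_
          (tendsto_fst_dirFilter _)
          (((EuclideanSpace.proj (𝕜 := ℝ) i).continuous.tendsto _).comp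
            (tendsto_snd_dirFilter _))).congr fun p => ?_
      · intro hx
        rw [blockNormDir, if_pos hx]
        exact blockNorm_nonneg
      · rw [quot, separableSum, separableSum, ← Finset.sum_sub_distrib, Finset.sum_div]
        rfl
    refine le_trans ?_ (le_iSup₂ ξ hact)
    have hpair : pairParabolic ξ (blockNorms q J) x w z
        = (∑ i, (a i : EReal) * Q i) + ((∑ i, a i * D i : ℝ) : EReal) := by
      rw [coe_sum_ereal, ← Finset.sum_add_distrib]
      refine Finset.sum_congr rfl fun i _ => ?_
      rw [hψ z i (D i) (hD i), ← coe_mul_add_coe (D i) (hor' i)]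
      rfl
    rw [hpair]
    refine add_le_add le_rfl (EReal.coe_le_coe_iff.2 ?_)
    rw [inner_eq_sum_blockInner hJ]
    refine Finset.sum_le_sum fun i _ => ?_
    -- Divide `⟨v, w + (τ / 2) z'⟩ ≤ a dN(w + (τ / 2) z')`, an equality at `z' = 0`, by `τ / 2`.
    have hlim : Tendsto (fun p : ℝ × EuclideanSpace ℝ (Fin n) => blockInner (J i) v p.2)
        (dirFilter z) (𝓝 (blockInner (J i) v z)) :=
      ((continuous_blockInner v).tendsto z).comp (tendsto_snd_dirFilter z)
    refine le_of_tendsto_of_tendsto hlim ((hD i).const_mul (a i)) ?_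
    filter_upwards [eventually_pos_dirFilter z] with p hp
    have h1 := hblock i (w + (p.1 / 2) • p.2)
    rw [blockInner_add_smul, hcrit i] at h1
    rw [← mul_div_assoc, le_div_iff₀ (half_pos hp)]
    linarith

end

end VarAnalysis

theorem proposition5p3 {n m : ℕ} (q : ℝ) (hq : 1 < q)
    (J : Fin m → Finset (Fin n)) (hJ : VarAnalysis.IsBlockPartition J)
    (lam : ℝ) (hlam : 0 < lam) (ρ : ℝ → ℝ) (hρ : VarAnalysis.IsPenalty lam ρ)
    (x v : EuclideanSpace ℝ (Fin n))
    (hv : v ∈ VarAnalysis.subdiff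
      (VarAnalysis.realToExt fun y => VarAnalysis.separableSum ρ (VarAnalysis.blockNorms q J y)) x)
    (hmono : q < 2 → VarAnalysis.HasMixedBlock J x → MonotoneOn ρ (Set.Ici 0)) :
    -- the semiderivatives and (possibly infinite) parabolic semiderivatives exist
    VarAnalysis.MapSemidifferentiableAt (VarAnalysis.blockNorms q J) x ∧
    (∀ (w z : EuclideanSpace ℝ (Fin n)) (i : Fin m), ∃ L : EReal,
      VarAnalysis.HasParabolicSemideriv (fun y => VarAnalysis.blockNorms q J y i) x w z L) ∧
    (2 ≤ q ∨ ¬ VarAnalysis.HasMixedBlock J x →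
      VarAnalysis.MapParabolicallySemidifferentiableAt (VarAnalysis.blockNorms q J) x) ∧
    VarAnalysis.SufficientCondition (VarAnalysis.realToExt (VarAnalysis.separableSum ρ))
      (VarAnalysis.blockNorms q J) x v ∧
    VarAnalysis.ParabolicallyRegularAt
      (VarAnalysis.realToExt fun y => VarAnalysis.separableSum ρ (VarAnalysis.blockNorms q J y)) x v ∧
    VarAnalysis.ProperlyTwiceEpiDifferentiableAt
      (VarAnalysis.realToExt fun y => VarAnalysis.separableSum ρ (VarAnalysis.blockNorms q J y)) x v := by
  open VarAnalysis in
  have hsemi : MapSemidifferentiableAt (blockNorms q J) x := fun w i =>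
    ⟨_, tendsto_quot_blockNorms hq x w i⟩
  have hepi := hρ.exists_epiLimAt_groupPenalty hlam hq hJ hv hmono
  refine ⟨hsemi, fun w z i => ?_, fun hfin => ⟨hsemi, fun w z i => ?_⟩,
    hρ.sufficientCondition hlam hq hJ hv hmono,
    parabolicallyRegularAt_of_epiLimAt hepi, properlyTwiceEpiDifferentiableAt_of_epiLimAt hepi⟩
  · obtain ⟨Q, hQ, -⟩ := exists_epiLimAt_blockNorm (J := J i) hq x w
    obtain ⟨D, hD⟩ := exists_tendsto_blockNormDir (J := J i) hq x w z
    exact ⟨_, hasParabolicSemideriv_blockNorm hq (hQ z) hD⟩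
  · obtain ⟨Q, hQ, -, hQfin⟩ := exists_epiLimAt_blockNorm (J := J i) hq x w
    obtain ⟨D, hD⟩ := exists_tendsto_blockNormDir (J := J i) hq x w z
    obtain ⟨c, rfl, -⟩ := hQfin (hfin.imp_right fun hmix hcon => hmix ⟨i, hcon⟩)
    exact ⟨c + D, by
      rw [EReal.coe_add]
      exact hasParabolicSemideriv_blockNorm hq (hQ z) hD⟩
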